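/- Let $(\mathbb M,g)$ be a smooth Riemannian manifold of dimension $n+m$ with a foliation $\mathcal F$ whose leaves are $m$-dimensional and totally geodesic and for which $g$ is bundle-like. Let $\mathcal V$ be the bundle tangent to the leaves, $\mathcal H=\mathcal V^\perp$, and let $\pi_{\mathcal V},\pi_{\mathcal H}$ be the orthogonal projections. Let $\nabla^g$ be the Levi-Civita connection and $\nabla$ the Bott connection: $\nabla_XY=\pi_{\mathcal H}(\nabla^g_XY)$ for $X,Y\in\Gamma^\infty(\mathcal H)$, $\nabla_XY=\pi_{\mathcal H}([X,Y])$ for $X\in\Gamma^\infty(\mathcal V),Y\in\Gamma^\infty(\mathcal H)$, $\nabla_XY=\pi_{\mathcal V}([X,Y])$ for $X\in\Gamma^\infty(\mathcal H),Y\in\Gamma^\infty(\mathcal V)$, and $\nabla_XY=\pi_{\mathcal V}(\nabla^g_XY)$ for $X,Y\in\Gamma^\infty(\mathcal V)$. Let $R(X,Y)=[\nabla_X,\nabla_Y]-\nabla_{[X,Y]}$ be its curvature. The horizontal curvature operator $R_{\mathcal H}:\wedge^2\mathcal H^*\to\wedge^2\mathcal H^*$ is the linear operator with $$R_{\mathcal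 H}(\beta_1\wedge\beta_2)(v,w)=\langle R(\sharp\beta_1,\sharp\beta_2)w,v\rangle_g,\qquad \beta_1,\beta_2\in\mathcal H^*,\ v,w\in\mathcal H .$$ For $\nu\in\wedge^\bullet T^*\mathbb M\otimes\wedge^\bullet T\mathbb M$ let $C_\nu:\wedge^\bullet T^*\mathbb M\to\wedge^\bullet T^*\mathbb M$ be the operator, linear in $\nu$, with $C_{\alpha\otimes X_1\wedge\cdots\wedge X_j}\eta=\alpha\wedge(\iota_{X_j}\cdots\iota_{X_1}\eta)$. Let $\mathrm{Ric}_{\mathcal H}=(\mathrm{Ric}_{\mathcal H})_{1,1}+(\mathrm{Ric}_{\mathcal H})_{2,2}$, where, for a local orthonormal frame $X_1,\dots,X_n$ of $\mathcal H$, $$(\mathrm{Ric}_{\mathcal H})_{1,1}(v)=-\sum_{p=1}^n R(X_p,v)X_p,\qquad (\mathrm{Ric}_{\mathcal H})_{2,2}(v,w)=\sum_{p=1}^n X_p\wedge R(v,w)X_p ,$$ viewed as sections of $T^*\mathbb M\otimes T\mathbb M$ and $\wedge^2T^*\mathbb M\otimes\wedge^2T\mathbb M$. For $\varepsilon>0$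 let $\langle\cdot,\cdot\rangle_\varepsilon$ and $\|\cdot\|_\varepsilon$ be the inner product and norm on forms induced by $g_\varepsilon=g_{\mathcal H}\oplus\frac1\varepsilon g_{\mathcal V}$, and let $\wedge^{(i,j)}T^*\mathbb M$ be the span of the forms $\alpha\wedge\beta$ with $\alpha$ an $i$-form vanishing on $\mathcal V$ and $\beta$ a $j$-form vanishing on $\mathcal H$. Assume that for some constant $c>0$ one has $\langle R_{\mathcal H}(\alpha),\alpha\rangle_{\mathcal H}\ge c\,\|\alpha\|_{\mathcal H}^2$ for all $\alpha\in\wedge^2\mathcal H^*$. Then there is a constant $c_1>0$ such that, for all $i\neq 0,n$, all $j$, all $\alpha\in\wedge^{(i,j)}T^*\mathbb M$ and all $\varepsilon>0$, $$\langle C_{\mathrm{Ric}_{\mathcal H}}\alpha,\alpha\rangle_\varepsilon\ \ge\ c_1\,\|\alpha\|_\varepsilon^2 .$$ -/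

import Mathlib

open Bundle Manifold
open scoped ContDiff TensorProduct

noncomputable section

namespace BochnerFoliation

/-! ### Fermion calculus on the exterior algebra of a Euclidean vector space

`T` plays the role of a tangent space; `V` is its vertical subspace and `Vᗮ` its horizontal one.
Forms are elements of the exterior algebra of the dual of `T`, multivectors are elements of the
exterior algebra of `T`. -/

section Algebra

variable {T : Type*} [NormedAddCommGroup T] [InnerProductSpace ℝ T]

/-- The space `⋀ T*` of forms. -/
abbrev Forms (T : Type*) [NormedAddCommGroup T] [InnerProductSpace ℝ T] : Type _ :=
  ExteriorAlgebra ℝ (Module.Dual ℝ T)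

/-- The contraction `ι_X` of forms by a vector `X`: the antiderivation of `⋀ T*` with
`ι_X a = a X` for covectors `a`. -/
def contraction : T →ₗ[ℝ] Module.End ℝ (Forms T) :=
  CliffordAlgebra.contractLeft ∘ₗ Module.Dual.eval ℝ T

theorem contraction_mul_self (X : T) : contraction X * contraction X = 0 :=
  LinearMap.ext fun φ => CliffordAlgebra.contractLeft_contractLeft (Module.Dual.eval ℝ T X) φ

/-- The operator `C_χ` of a multivector `χ`; it satisfies `C_X = ι_X` and
`C_{X ∧ χ} = C_χ C_X`. -/
def multiContraction : ExteriorAlgebra ℝ T →ₗ[ℝ] Module.End ℝ (Forms T) :=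
  (ExteriorAlgebra.lift ℝ ⟨contraction, contraction_mul_self⟩).toLinearMap ∘ₗ
    CliffordAlgebra.reverse

/-- The operator `C_ν` on forms, for `ν ∈ ⋀ T* ⊗ ⋀ T`: it is linear in `ν` and
`C_{α ⊗ χ} η = α ∧ C_χ η`. -/
def fermion : Forms T ⊗[ℝ] ExteriorAlgebra ℝ T →ₗ[ℝ] Module.End ℝ (Forms T) :=
  TensorProduct.lift ((LinearMap.mul ℝ (Module.End ℝ (Forms T))).compl₁₂
    (Algebra.lmul ℝ (Forms T)).toLinearMap multiContraction)

/-- The covector `♭X = ⟨X, ·⟩`. -/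
def flat (X : T) : Module.Dual ℝ T := innerₗ T X

/-- The space `⋀^(i,j) T*`, spanned by the products `α ∧ β`, where `α` is a product of `i`
covectors vanishing on `V` and `β` is a product of `j` covectors vanishing on `Vᗮ`. -/
def bidegree (V : Submodule ℝ T) (i j : ℕ) : Submodule ℝ (Forms T) :=
  (V.dualAnnihilator.map (ExteriorAlgebra.ι ℝ)) ^ i *
    (Vᗮ.dualAnnihilator.map (ExteriorAlgebra.ι ℝ)) ^ j

variable [FiniteDimensional ℝ T]

/-- The musical isomorphism `♯` of the inner product of `T`, as a map from covectors to vectors. -/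
def sharp : Module.Dual ℝ T →ₗ[ℝ] T where
  toFun a := (InnerProductSpace.toDual ℝ T).symm (LinearMap.toContinuousLinearMap a)
  map_add' a b := by simp
  map_smul' r a := by simp

/-- The musical isomorphism of the rescaled inner product `g_ε = g_H ⊕ ε⁻¹ g_V`. It is
determined by `g_ε (♯_ε a, X) = a X`, so that the inner product induced by `g_ε` on covectors is
`⟨a, b⟩_ε = b (♯_ε a) = ⟨a, b⟩_H + ε ⟨a, b⟩_V`. -/
def sharpEps (V : Submodule ℝ T) (ε : ℝ) : Module.Dual ℝ T →ₗ[ℝ] T :=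
  (Vᗮ.starProjection.toLinearMap + ε • V.starProjection.toLinearMap) ∘ₗ sharp

/-- The inner product `⟨φ, η⟩_ε` on forms induced by `g_ε`: the degree zero part of `C_{♯_ε φ} η`.
Forms of different degrees are orthogonal, and `⟨a₁ ∧ ⋯ ∧ a_k, b₁ ∧ ⋯ ∧ b_k⟩_ε` is the
determinant of the matrix with entries `⟨a_p, b_q⟩_ε`. -/
def formInner (V : Submodule ℝ T) (ε : ℝ) (φ η : Forms T) : ℝ :=
  ExteriorAlgebra.algebraMapInv
    (multiContraction (ExteriorAlgebra.map (sharpEps V ε) φ) η)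

/-- The `p`-th vector `X_p` of an orthonormal basis of the horizontal space `Vᗮ`. -/
def horizontalFrame (V : Submodule ℝ T) (p : Fin (Module.finrank ℝ Vᗮ)) : T :=
  (stdOrthonormalBasis ℝ Vᗮ p : T)

/-- The horizontal curvature operator of a curvature tensor `R` on two-forms `φ`. It is linear in
`φ` and, when `R X Y` depends linearly and alternatingly on `X` and `Y` and is skew-symmetric on
horizontal vectors, it is given on horizontal covectors by
`R_H (β₁ ∧ β₂) (v, w) = ⟨R (♯β₁) (♯β₂) w, v⟩`. The scalar `algebraMapInv (ι_Y (ι_X φ))` is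
`φ (X, Y)`. -/
def curvatureOperator (V : Submodule ℝ T) (R : T → T → T → T) (φ : Forms T) : Forms T :=
  ∑ p, ∑ q, ∑ r, ∑ s,
    ((1 / 4 : ℝ) *
      ExteriorAlgebra.algebraMapInv
        (contraction (horizontalFrame V q) (contraction (horizontalFrame V p) φ)) *
      inner ℝ (R (horizontalFrame V p) (horizontalFrame V q) (horizontalFrame V s))
        (horizontalFrame V r)) •
    (ExteriorAlgebra.ι ℝ (flat (horizontalFrame V r)) *
      ExteriorAlgebra.ι ℝ (flat (horizontalFrame V s)))

/-- `Ric_{1,1} (v) = - tr_H R(×, v) ×`, as a vector. -/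
def ricciOneVector (V : Submodule ℝ T) (R : T → T → T → T) (v : T) : T :=
  -∑ p, R (horizontalFrame V p) v (horizontalFrame V p)

/-- `Ric_{2,2} (v, w) = ∑ X_p ∧ R(v, w) X_p`, as a bivector. When `R(v, w)` preserves
`Vᗮ` and is skew-symmetric on it, its pairing with `α ∧ β` is `2 ⟨R(v, w) α, β⟩_{g_H^*}`, where
`R(v, w) α = - α ∘ R(v, w)`. -/
def ricciTwoBivector (V : Submodule ℝ T) (R : T → T → T → T) (v w : T) : ExteriorAlgebra ℝ T :=
  ∑ p, ExteriorAlgebra.ι ℝ (horizontalFrame V p) *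
    ExteriorAlgebra.ι ℝ (R v w (horizontalFrame V p))

/-- `Ric_{1,1}` as an element of `T* ⊗ T`. -/
def ricciOne (V : Submodule ℝ T) (R : T → T → T → T) : Forms T ⊗[ℝ] ExteriorAlgebra ℝ T :=
  ∑ a, ExteriorAlgebra.ι ℝ (flat (stdOrthonormalBasis ℝ T a)) ⊗ₜ[ℝ]
    ExteriorAlgebra.ι ℝ (ricciOneVector V R (stdOrthonormalBasis ℝ T a))

/-- `Ric_{2,2}` as an element of `⋀² T* ⊗ ⋀² T`. -/
def ricciTwo (V : Submodule ℝ T) (R : T → T → T → T) : Forms T ⊗[ℝ] ExteriorAlgebra ℝ T :=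
  (1 / 2 : ℝ) • ∑ a, ∑ b,
    (ExteriorAlgebra.ι ℝ (flat (stdOrthonormalBasis ℝ T a)) *
      ExteriorAlgebra.ι ℝ (flat (stdOrthonormalBasis ℝ T b))) ⊗ₜ[ℝ]
    ricciTwoBivector V R (stdOrthonormalBasis ℝ T a) (stdOrthonormalBasis ℝ T b)

/-- The Weitzenböck operator `C_Ric`, `Ric = Ric_{1,1} + Ric_{2,2}`. -/
def ricciOperator (V : Submodule ℝ T) (R : T → T → T → T) : Module.End ℝ (Forms T) :=
  fermion (ricciOne V R + ricciTwo V R)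

end Algebra

/-! ### Totally geodesic Riemannian foliations and the Bott connection -/

section Geometry

variable {E : Type*} [NormedAddCommGroup E] [NormedSpace ℝ E]
  {M : Type*} [TopologicalSpace M] [ChartedSpace E M]

instance (x : M) [h : FiniteDimensional ℝ E] : FiniteDimensional ℝ (TangentSpace 𝓘(ℝ, E) x) := h

/-- Vector fields on `M` (with no regularity). -/
abbrev VecField (E M : Type*) [NormedAddCommGroup E] [NormedSpace ℝ E] [TopologicalSpace M]
    [ChartedSpace E M] : Type _ :=
  ∀ x : M, TangentSpace 𝓘(ℝ, E) x

/-- Distributions on `M` (with no regularity). -/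
abbrev Distribution (E M : Type*) [NormedAddCommGroup E] [NormedSpace ℝ E] [TopologicalSpace M]
    [ChartedSpace E M] : Type _ :=
  ∀ x : M, Submodule ℝ (TangentSpace 𝓘(ℝ, E) x)

/-- The Lie bracket of vector fields. -/
abbrev bracket (X Y : VecField E M) : VecField E M :=
  VectorField.mlieBracket 𝓘(ℝ, E) X Y

/-- The vector field `X` is smooth on the set `U`. -/
def SmoothOn [IsManifold 𝓘(ℝ, E) ∞ M] (X : VecField E M) (U : Set M) : Prop :=
  ContMDiffOn 𝓘(ℝ, E) (𝓘(ℝ, E).prod 𝓘(ℝ, E)) ∞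
    (fun x => TotalSpace.mk' E (E := (TangentSpace 𝓘(ℝ, E) : M → Type _)) x (X x)) U

/-- `X` is a section of the distribution `D` over `U`, smooth on `U`. -/
def IsSection [IsManifold 𝓘(ℝ, E) ∞ M] (D : Distribution E M) (X : VecField E M) (U : Set M) :
    Prop :=
  SmoothOn X U ∧ ∀ x ∈ U, X x ∈ D x

/-- `D` is a smooth distribution of rank `m`: around each point it has a smooth frame. -/
def IsSmoothDistribution [IsManifold 𝓘(ℝ, E) ∞ M] (D : Distribution E M) (m : ℕ) : Prop :=
  ∀ x : M, ∃ U : Set M, IsOpen U ∧ x ∈ U ∧ ∃ Z : Fin m → VecField E M,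
    (∀ l, SmoothOn (Z l) U) ∧
    ∀ y ∈ U, LinearIndependent ℝ (fun l => Z l y) ∧
      Submodule.span ℝ (Set.range fun l => Z l y) = D y

/-- `D` is involutive (equivalently, tangent to the leaves of a foliation). -/
def IsInvolutive [IsManifold 𝓘(ℝ, E) ∞ M] (D : Distribution E M) : Prop :=
  ∀ U : Set M, IsOpen U → ∀ X Y : VecField E M, IsSection D X U → IsSection D Y U →
    ∀ x ∈ U, bracket X Y x ∈ D x

variable [RiemannianBundle (fun x : M => TangentSpace 𝓘(ℝ, E) x)]

/-- The function `x ↦ ⟨X x, Y x⟩`. -/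
def metric (X Y : VecField E M) (x : M) : ℝ := inner ℝ (X x) (Y x)

/-- The horizontal distribution: the orthogonal complement of the vertical distribution. -/
def horizontal (V : Distribution E M) : Distribution E M := fun x => (V x)ᗮ

/-- The Lie derivative of the metric, `(L_Z g)(X, Y) = Z g(X, Y) - g([Z, X], Y) - g(X, [Z, Y])`. -/
def lieDerivMetric (Z X Y : VecField E M) (x : M) : ℝ :=
  mvfderiv 𝓘(ℝ, E) (metric X Y) x (Z x) - metric (bracket Z X) Y x - metric X (bracket Z Y) x

/-- The right-hand side of the Koszul formula, halved: it is `⟨∇^g_X Y, W⟩`. -/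
def koszul (X Y W : VecField E M) (x : M) : ℝ :=
  (1 / 2 : ℝ) *
    (mvfderiv 𝓘(ℝ, E) (metric Y W) x (X x) + mvfderiv 𝓘(ℝ, E) (metric X W) x (Y x)
      - mvfderiv 𝓘(ℝ, E) (metric X Y) x (W x)
      + metric (bracket X Y) W x - metric (bracket X W) Y x - metric (bracket Y W) X x)

variable [FiniteDimensional ℝ E] [IsManifold 𝓘(ℝ, E) ∞ M]

/-- An extension of a tangent vector to a vector field, smooth around the base point. -/
def extendVec {x : M} (v : TangentSpace 𝓘(ℝ, E) x) : VecField E M :=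
  FiberBundle.extend E (E := (TangentSpace 𝓘(ℝ, E) : M → Type _)) v

/-- The Levi-Civita connection `∇^g_X Y`: its value at `x` is the vector whose inner products with
tangent vectors at `x` are given by the Koszul formula. -/
def leviCivita (X Y : VecField E M) : VecField E M := fun x =>
  ∑ a, koszul X Y (extendVec (stdOrthonormalBasis ℝ (TangentSpace 𝓘(ℝ, E) x) a)) x •
    stdOrthonormalBasis ℝ (TangentSpace 𝓘(ℝ, E) x) a

/-- The pointwise orthogonal projection of a vector field to a distribution. -/
def proj (D : Distribution E M) (X : VecField E M) : VecField E M := fun x =>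
  (D x).starProjection (X x)

/-- The Bott connection `∇_X Y` of the foliation tangent to `V`: it is `π_H (∇^g_X Y)` for `X`, `Y`
horizontal, `π_H [X, Y]` for `X` vertical and `Y` horizontal, `π_V [X, Y]` for `X` horizontal and
`Y` vertical, and `π_V (∇^g_X Y)` for `X`, `Y` vertical. -/
def bott (V : Distribution E M) (X Y : VecField E M) : VecField E M :=
  proj (horizontal V) (leviCivita (proj (horizontal V) X) (proj (horizontal V) Y)) +
  proj (horizontal V) (bracket (proj V X) (proj (horizontal V) Y)) +
  proj V (bracket (proj (horizontal V) X) (proj V Y)) +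
  proj V (leviCivita (proj V X) (proj V Y))

/-- The curvature tensor `R(u, v) w = ∇_X ∇_Y W - ∇_Y ∇_X W - ∇_[X, Y] W` of the Bott connection,
where `X`, `Y`, `W` are vector fields, smooth around `x`, with values `u`, `v`, `w` at `x`. -/
def bottCurvature (V : Distribution E M) (x : M) (u v w : TangentSpace 𝓘(ℝ, E) x) :
    TangentSpace 𝓘(ℝ, E) x :=
  (bott V (extendVec u) (bott V (extendVec v) (extendVec w)) -
    bott V (extendVec v) (bott V (extendVec u) (extendVec w)) -
    bott V (bracket (extendVec u) (extendVec v)) (extendVec w)) x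

/-- The distribution `V` is tangent to a foliation with leaves of dimension `m` for which the metric
of `M` is bundle-like and whose leaves are totally geodesic. -/
structure IsTotallyGeodesicRiemannianFoliation (V : Distribution E M) (m : ℕ) : Prop where
  smooth : IsSmoothDistribution V m
  involutive : IsInvolutive V
  /-- The metric is bundle-like: `(L_Z g)(X, X) = 0` for `Z` vertical and `X` horizontal. -/
  bundleLike : ∀ U : Set M, IsOpen U → ∀ Z X : VecField E M, IsSection V Z U →
    IsSection (horizontal V) X U → ∀ x ∈ U, lieDerivMetric Z X X x = 0
  /-- The leaves are totally geodesic: `∇^g_Z W` is vertical for `Z` and `W` vertical. -/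
  totallyGeodesic : ∀ U : Set M, IsOpen U → ∀ Z W : VecField E M, IsSection V Z U →
    IsSection V W U → ∀ x ∈ U, leviCivita Z W x ∈ V x

/-- The horizontal curvature operator `R_H` of the Bott connection at `x`, on horizontal
two-forms. -/
def horizontalCurvatureOperator (V : Distribution E M) (x : M) :
    Forms (TangentSpace 𝓘(ℝ, E) x) → Forms (TangentSpace 𝓘(ℝ, E) x) :=
  curvatureOperator (V x) (bottCurvature V x)

/-- The operator `C_{Ric_H}` at `x`: the Weitzenböck operator of the curvature of the Bott
connection. -/
def horizontalRicciOperator (V : Distribution E M) (x : M) :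
    Module.End ℝ (Forms (TangentSpace 𝓘(ℝ, E) x)) :=
  ricciOperator (V x) (bottCurvature V x)

end Geometry

end BochnerFoliation

end

/-! After the curvature symmetries are known, everything is linear algebra in one tangent space.
Take a horizontal orthonormal frame X_p and K_{abrs} = ⟨R(X_a, X_b) X_s, X_r⟩. The Bianchi identity
and the anticommutation of wedge and contraction merge the two parts of the Weitzenböck operator
into Σ K_{abrs} ♭X_a ∧ ι_{X_b} (♭X_s ∧ ι_{X_r} ·) (`ricciOperator_apply`). By adjointness, ⟨C_Ric α,
α⟩_ε = Σ K_{abrs} ⟨ω_ab, ω_rs⟩_ε with ω_ab = ♭X_b ∧ ι_{X_a} α (`formInner_ricciOperator`). The Gram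
matrix of the ω_ab is positive semidefinite, hence a sum of rank-one matrices f_t f_tᵀ. Each of them
contributes ⟨R_H φ_t, φ_t⟩ for the two-form φ_t = Σ f_t(a, b) ♭X_a ∧ ♭X_b, which is at least c‖φ_t‖²
(`le_sum_curvatureComponent`). Finally Σ ‖φ_t‖² = Σ (⟨ω_ab, ω_ab⟩ - ⟨ω_ab, ω_ba⟩) = i(n - i)‖α‖²_ε,
the Casimir eigenvalue of so(n) on horizontal i-forms (`sum_formInner_rotation`), and i(n - i) ≥ 1
for 0 < i < n. The bound is uniform in ε because adjoints of horizontal wedges do not involve ε.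

The geometric input is that the horizontal Bott curvature has the symmetries of a Riemannian
curvature tensor. The Bott connection is the sum of two halves (`partialBott`), one acting in each
bundle. The bundle-like condition makes the horizontal half metric, and involutivity makes its
torsion vertical; this yields skew-symmetry and the Bianchi identity. Totally geodesic leaves make
the vertical half metric, so that R(u, v)w has no vertical part for horizontal w. Linearity of the
curvature, which is defined through chosen extensions of vectors, comes from pair symmetry, a formal
consequence of the pointwise identities. -/

noncomputable section

namespace BochnerFoliation

/-! ### Wedge and contraction operators, and the inner products of forms -/

section Fermions

variable {T : Type*} [NormedAddCommGroup T] [InnerProductSpace ℝ T]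

/-- Exterior multiplication by the covector `♭X`. -/
def wedge : T →ₗ[ℝ] Module.End ℝ (Forms T) :=
  (Algebra.lmul ℝ (Forms T)).toLinearMap ∘ₗ ExteriorAlgebra.ι ℝ ∘ₗ innerₗ T

theorem wedge_apply (X : T) (φ : Forms T) : wedge X φ = ExteriorAlgebra.ι ℝ (flat X) * φ := rfl

theorem contraction_ι_mul (X : T) (a : Module.Dual ℝ T) (φ : Forms T) :
    contraction X (ExteriorAlgebra.ι ℝ a * φ) =
      a X • φ - ExteriorAlgebra.ι ℝ a * contraction X φ :=
  CliffordAlgebra.contractLeft_ι_mul _ _ _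

theorem contraction_algebraMap (X : T) (r : ℝ) :
    contraction X (algebraMap ℝ (Forms T) r) = 0 :=
  CliffordAlgebra.contractLeft_algebraMap _ _ _

theorem contraction_wedge (X Y : T) (φ : Forms T) :
    contraction X (wedge Y φ) = inner ℝ Y X • φ - wedge Y (contraction X φ) :=
  contraction_ι_mul X (flat Y) φ

theorem contraction_comm (X Y : T) (φ : Forms T) :
    contraction X (contraction Y φ) = -contraction Y (contraction X φ) :=
  CliffordAlgebra.contractLeft_comm _ _ _

theorem wedge_comm (X Y : T) (φ : Forms T) : wedge X (wedge Y φ) = -wedge Y (wedge X φ) := by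
  have h := ExteriorAlgebra.ι_add_mul_swap (flat X) (flat Y) (R := ℝ)
  rw [eq_neg_iff_add_eq_zero]
  simp only [wedge_apply, ← mul_assoc, ← add_mul, h, zero_mul]

theorem multiContraction_one : multiContraction (1 : ExteriorAlgebra ℝ T) = 1 := by
  simp [multiContraction]

theorem multiContraction_algebraMap (r : ℝ) :
    multiContraction (algebraMap ℝ (ExteriorAlgebra ℝ T) r) = algebraMap ℝ _ r := by
  simp [multiContraction]

theorem multiContraction_ι_mul (X : T) (χ : ExteriorAlgebra ℝ T) :
    multiContraction (ExteriorAlgebra.ι ℝ X * χ) = multiContraction χ * contraction X := by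
  simp [multiContraction, CliffordAlgebra.reverse.map_mul]

theorem multiContraction_ι (X : T) :
    multiContraction (ExteriorAlgebra.ι ℝ X) = contraction X := by
  simpa [multiContraction_one] using multiContraction_ι_mul X 1

theorem multiContraction_ι_mul_ι (X Y : T) :
    multiContraction (ExteriorAlgebra.ι ℝ X * ExteriorAlgebra.ι ℝ Y) =
      contraction Y * contraction X := by
  rw [multiContraction_ι_mul, multiContraction_ι]

theorem fermion_tmul (α : Forms T) (χ : ExteriorAlgebra ℝ T) (φ : Forms T) :
    fermion (α ⊗ₜ[ℝ] χ) φ = α * multiContraction χ φ := rfl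

/-- The space of homogeneous forms of degree `k`. -/
def homogeneous (T : Type*) [NormedAddCommGroup T] [InnerProductSpace ℝ T] (k : ℕ) :
    Submodule ℝ (Forms T) :=
  (LinearMap.range (ExteriorAlgebra.ι ℝ (M := Module.Dual ℝ T))) ^ k

theorem homogeneous_succ_induction {k : ℕ} {p : Forms T → Prop} {φ : Forms T}
    (hφ : φ ∈ homogeneous T (k + 1))
    (hmul : ∀ (a : Module.Dual ℝ T), ∀ ψ ∈ homogeneous T k, p (ExteriorAlgebra.ι ℝ a * ψ))
    (hadd : ∀ φ ψ, p φ → p ψ → p (φ + ψ)) : p φ := by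
  rw [homogeneous, pow_succ'] at hφ
  refine Submodule.mul_induction_on hφ ?_ hadd
  rintro _ ⟨a, rfl⟩ ψ hψ
  exact hmul a ψ hψ

theorem ι_mul_mem_homogeneous {k : ℕ} (a : Module.Dual ℝ T) {φ : Forms T}
    (hφ : φ ∈ homogeneous T k) : ExteriorAlgebra.ι ℝ a * φ ∈ homogeneous T (k + 1) := by
  rw [homogeneous, pow_succ']
  exact Submodule.mul_mem_mul ⟨a, rfl⟩ hφ

theorem wedge_mem_homogeneous {k : ℕ} (X : T) {φ : Forms T} (hφ : φ ∈ homogeneous T k) :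
    wedge X φ ∈ homogeneous T (k + 1) :=
  ι_mul_mem_homogeneous _ hφ

theorem mem_homogeneous_zero {φ : Forms T} (hφ : φ ∈ homogeneous T 0) :
    ∃ r : ℝ, φ = algebraMap ℝ (Forms T) r := by
  rw [homogeneous, pow_zero, Submodule.mem_one] at hφ
  obtain ⟨r, hr⟩ := hφ
  exact ⟨r, hr.symm⟩

theorem contraction_mem_homogeneous (X : T) {k : ℕ} {φ : Forms T}
    (hφ : φ ∈ homogeneous T (k + 1)) : contraction X φ ∈ homogeneous T k := by
  induction k generalizing φ with
  | zero =>
    refine homogeneous_succ_induction (p := fun φ => contraction X φ ∈ _) hφ ?_ ?_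
    · intro a ψ hψ
      obtain ⟨r, rfl⟩ := mem_homogeneous_zero hψ
      rw [contraction_ι_mul, contraction_algebraMap, mul_zero, sub_zero]
      exact Submodule.smul_mem _ _ hψ
    · intro φ ψ h₁ h₂
      rw [map_add]
      exact Submodule.add_mem _ h₁ h₂
  | succ k ih =>
    refine homogeneous_succ_induction (p := fun φ => contraction X φ ∈ _) hφ ?_ ?_
    · intro a ψ hψ
      rw [contraction_ι_mul]
      exact Submodule.sub_mem _ (Submodule.smul_mem _ _ hψ) (ι_mul_mem_homogeneous _ (ih hψ))
    · intro φ ψ h₁ h₂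
      rw [map_add]
      exact Submodule.add_mem _ h₁ h₂

theorem bidegree_le_homogeneous (V : Submodule ℝ T) (i j : ℕ) :
    bidegree V i j ≤ homogeneous T (i + j) := by
  rw [bidegree, homogeneous, pow_add]
  exact mul_le_mul' (pow_le_pow_left' LinearMap.map_le_range i)
    (pow_le_pow_left' LinearMap.map_le_range j)

variable [FiniteDimensional ℝ T]

/-- The operator `∑ ♭X_p ∧ ι_{X_p}`, for an orthonormal basis `X_p` of `W`. -/
def numberOperator (W : Submodule ℝ T) : Module.End ℝ (Forms T) :=
  ∑ p, wedge (stdOrthonormalBasis ℝ W p : T) * contraction (stdOrthonormalBasis ℝ W p : T)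

theorem numberOperator_apply (W : Submodule ℝ T) (φ : Forms T) :
    numberOperator W φ =
      ∑ p, wedge (stdOrthonormalBasis ℝ W p : T) (contraction (stdOrthonormalBasis ℝ W p : T) φ) := by
  simp [numberOperator]

theorem sum_inner_smul_stdOrthonormalBasis (W : Submodule ℝ T) (v : T) :
    ∑ p, inner ℝ (stdOrthonormalBasis ℝ W p : T) v • (stdOrthonormalBasis ℝ W p : T) =
      W.starProjection v := by
  rw [Submodule.starProjection_apply]
  rw [← (stdOrthonormalBasis ℝ W).sum_repr (W.orthogonalProjectionOnto v)]
  push_cast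
  refine Finset.sum_congr rfl fun p _ => ?_
  rw [OrthonormalBasis.repr_apply_apply, ← Submodule.inner_orthogonalProjectionOnto_eq_of_mem_left]

theorem sum_apply_smul_flat (W : Submodule ℝ T) (a : Module.Dual ℝ T) :
    ∑ p, a (stdOrthonormalBasis ℝ W p : T) • flat (stdOrthonormalBasis ℝ W p : T) =
      a ∘ₗ W.starProjection.toLinearMap := by
  ext v
  have h := congrArg a (sum_inner_smul_stdOrthonormalBasis W v)
  simp only [map_sum, map_smul, smul_eq_mul] at h
  simp only [LinearMap.sum_apply, LinearMap.smul_apply, flat, innerₗ_apply_apply, smul_eq_mul,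
    LinearMap.comp_apply, ContinuousLinearMap.coe_coe, ← h]
  exact Finset.sum_congr rfl fun p _ => mul_comm _ _

/-- The number operator is the derivation of the exterior algebra extending the transpose of the
orthogonal projection to `W`; this makes its eigenvalues count covectors. -/
theorem numberOperator_ι_mul (W : Submodule ℝ T) (a : Module.Dual ℝ T) (φ : Forms T) :
    numberOperator W (ExteriorAlgebra.ι ℝ a * φ) =
      ExteriorAlgebra.ι ℝ (a ∘ₗ W.starProjection.toLinearMap) * φ +
        ExteriorAlgebra.ι ℝ a * numberOperator W φ := by
  rw [← sum_apply_smul_flat, numberOperator_apply, numberOperator_apply, map_sum, Finset.sum_mul,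
    Finset.mul_sum, ← Finset.sum_add_distrib]
  refine Finset.sum_congr rfl fun p _ => ?_
  have h := ExteriorAlgebra.ι_add_mul_swap a (flat (stdOrthonormalBasis ℝ W p : T)) (R := ℝ)
  rw [contraction_ι_mul, map_sub, map_smul, wedge_apply, wedge_apply, wedge_apply, map_smul,
    smul_mul_assoc, sub_eq_add_neg, ← mul_assoc, ← mul_assoc, add_right_inj,
    eq_neg_of_add_eq_zero_left h, neg_mul]

/-- Eigenvalues of a derivation add over products. The case of use is `l = 1` for horizontal
covectors and `l = 0` for vertical ones. -/
theorem numberOperator_pow_mul (W : Submodule ℝ T) {S : Submodule ℝ (Forms T)} {s l : ℝ}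
    {A : Submodule ℝ (Module.Dual ℝ T)}
    (hA : ∀ a ∈ A, a ∘ₗ W.starProjection.toLinearMap = l • a)
    (hS : ∀ φ ∈ S, numberOperator W φ = s • φ) (i : ℕ) :
    ∀ φ ∈ (A.map (ExteriorAlgebra.ι ℝ)) ^ i * S, numberOperator W φ = (i * l + s) • φ := by
  induction i with
  | zero => simpa using hS
  | succ i ih =>
    intro φ hφ
    rw [pow_succ', mul_assoc] at hφ
    refine Submodule.mul_induction_on hφ ?_ ?_
    · rintro _ ⟨a, ha, rfl⟩ ψ hψ
      rw [numberOperator_ι_mul, hA a ha, ih ψ hψ, map_smul]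
      push_cast
      rw [smul_mul_assoc, mul_smul_comm, ← add_smul]
      ring_nf
    · intro φ ψ h₁ h₂
      rw [map_add, h₁, h₂, smul_add]

theorem numberOperator_one (W : Submodule ℝ T) :
    ∀ φ ∈ (1 : Submodule ℝ (Forms T)), numberOperator W φ = (0 : ℝ) • φ := by
  intro φ hφ
  obtain ⟨r, rfl⟩ := Submodule.mem_one.1 hφ
  simp [numberOperator_apply, contraction_algebraMap]

theorem numberOperator_orthogonal_bidegree (V : Submodule ℝ T) (i j : ℕ) {φ : Forms T}
    (hφ : φ ∈ bidegree V i j) : numberOperator Vᗮ φ = (i : ℝ) • φ := by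
  have h : ∀ φ ∈ (Vᗮ.dualAnnihilator.map (ExteriorAlgebra.ι ℝ)) ^ j * 1,
      numberOperator Vᗮ φ = ((j : ℝ) * 0 + 0) • φ := by
    refine numberOperator_pow_mul _ (fun a ha => ?_) (numberOperator_one _) j
    ext v
    simpa using (Submodule.mem_dualAnnihilator a).1 ha _ (Submodule.starProjection_apply_mem _ v)
  have h' := numberOperator_pow_mul Vᗮ (A := V.dualAnnihilator) (l := 1) (fun a ha => ?_) h i φ
    (by simpa [bidegree] using hφ)
  · simpa using h'
  · ext v
    have := (Submodule.mem_dualAnnihilator a).1 ha _ (Submodule.starProjection_apply_mem V v)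
    simp [Submodule.starProjection_orthogonal', this]

theorem numberOperator_add_numberOperator (V : Submodule ℝ T) (k : ℕ) {φ : Forms T}
    (hφ : φ ∈ homogeneous T k) : numberOperator Vᗮ φ + numberOperator V φ = (k : ℝ) • φ := by
  induction k generalizing φ with
  | zero =>
    obtain ⟨r, rfl⟩ := mem_homogeneous_zero hφ
    simp [numberOperator_apply, contraction_algebraMap]
  | succ k ih =>
    refine homogeneous_succ_induction (p := fun φ => numberOperator Vᗮ φ + numberOperator V φ =
      ((k + 1 : ℕ) : ℝ) • φ) hφ ?_ ?_
    · intro a ψ hψ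
      have h : a ∘ₗ Vᗮ.starProjection.toLinearMap + a ∘ₗ V.starProjection.toLinearMap = a := by
        ext v
        simp [Submodule.starProjection_orthogonal']
      rw [numberOperator_ι_mul, numberOperator_ι_mul, add_add_add_comm, ← add_mul, ← mul_add,
        ← map_add, h, ih hψ]
      push_cast
      rw [add_smul, one_smul, mul_smul_comm, add_comm]
    · intro φ ψ h₁ h₂
      rw [map_add, map_add, smul_add, ← h₁, ← h₂]
      abel

theorem inner_sharp (a : Module.Dual ℝ T) (v : T) : inner ℝ (sharp a) v = a v := by
  simp [sharp]

theorem sharp_flat (X : T) : sharp (flat X) = X :=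
  ext_inner_right ℝ fun v => by rw [inner_sharp]; rfl

theorem sharpEps_flat_of_mem_orthogonal (V : Submodule ℝ T) (ε : ℝ) {X : T} (hX : X ∈ Vᗮ) :
    sharpEps V ε (flat X) = X := by
  have h : V.starProjection X = 0 := by
    exact (Submodule.starProjection_apply_eq_zero_iff V).2 hX
  simp [sharpEps, sharp_flat, Submodule.starProjection_orthogonal', h]

theorem sharpEps_flat_of_mem (V : Submodule ℝ T) (ε : ℝ) {X : T} (hX : X ∈ V) :
    sharpEps V ε (flat X) = ε • X := by
  have h : V.starProjection X = X := Submodule.starProjection_eq_self_iff.2 hX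
  simp [sharpEps, sharp_flat, Submodule.starProjection_orthogonal', h]

theorem formInner_add_left (V : Submodule ℝ T) (ε : ℝ) (φ ψ η : Forms T) :
    formInner V ε (φ + ψ) η = formInner V ε φ η + formInner V ε ψ η := by
  simp [formInner]

theorem formInner_smul_left (V : Submodule ℝ T) (ε r : ℝ) (φ η : Forms T) :
    formInner V ε (r • φ) η = r * formInner V ε φ η := by
  simp [formInner]

theorem formInner_add_right (V : Submodule ℝ T) (ε : ℝ) (φ ψ η : Forms T) :
    formInner V ε φ (ψ + η) = formInner V ε φ ψ + formInner V ε φ η := by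
  simp [formInner]

theorem formInner_smul_right (V : Submodule ℝ T) (ε r : ℝ) (φ η : Forms T) :
    formInner V ε φ (r • η) = r * formInner V ε φ η := by
  simp [formInner]

/-- The bilinear form `⟨·, ·⟩_ε`. -/
def formInnerₗ (V : Submodule ℝ T) (ε : ℝ) : Forms T →ₗ[ℝ] Forms T →ₗ[ℝ] ℝ :=
  LinearMap.mk₂ ℝ (formInner V ε) (formInner_add_left V ε) (formInner_smul_left V ε)
    (formInner_add_right V ε) (formInner_smul_right V ε)

theorem formInnerₗ_apply (V : Submodule ℝ T) (ε : ℝ) (φ η : Forms T) :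
    formInnerₗ V ε φ η = formInner V ε φ η := rfl

theorem formInner_sum_left {κ : Type*} (s : Finset κ) (V : Submodule ℝ T) (ε : ℝ)
    (φ : κ → Forms T) (η : Forms T) :
    formInner V ε (∑ k ∈ s, φ k) η = ∑ k ∈ s, formInner V ε (φ k) η := by
  simp [← formInnerₗ_apply]

theorem formInner_sum_right {κ : Type*} (s : Finset κ) (V : Submodule ℝ T) (ε : ℝ)
    (φ : Forms T) (η : κ → Forms T) :
    formInner V ε φ (∑ k ∈ s, η k) = ∑ k ∈ s, formInner V ε φ (η k) := by
  simp [← formInnerₗ_apply]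

theorem formInner_ι_mul (V : Submodule ℝ T) (ε : ℝ) (a : Module.Dual ℝ T) (φ η : Forms T) :
    formInner V ε (ExteriorAlgebra.ι ℝ a * φ) η =
      formInner V ε φ (contraction (sharpEps V ε a) η) := by
  simp [formInner, multiContraction_ι_mul]

theorem formInner_wedge_of_mem_orthogonal (V : Submodule ℝ T) (ε : ℝ) {X : T} (hX : X ∈ Vᗮ)
    (φ η : Forms T) : formInner V ε (wedge X φ) η = formInner V ε φ (contraction X η) := by
  rw [wedge_apply, formInner_ι_mul, sharpEps_flat_of_mem_orthogonal V ε hX]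

theorem formInner_wedge_of_mem (V : Submodule ℝ T) (ε : ℝ) {X : T} (hX : X ∈ V)
    (φ η : Forms T) : formInner V ε (wedge X φ) η = ε * formInner V ε φ (contraction X η) := by
  rw [wedge_apply, formInner_ι_mul, sharpEps_flat_of_mem V ε hX, map_smul, LinearMap.smul_apply,
    formInner_smul_right]

theorem formInner_algebraMap (V : Submodule ℝ T) (ε r s : ℝ) :
    formInner V ε (algebraMap ℝ _ r) (algebraMap ℝ _ s) = r * s := by
  rw [formInner, AlgHom.commutes, multiContraction_algebraMap, Module.algebraMap_end_apply,
    map_smul, AlgHom.commutes]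
  rfl

/-- Euler's identity: the two number operators add up to the degree, and each wedge is moved across
as a contraction. It lowers the degree by one, so symmetry and nonnegativity of the inner product
follow by induction. -/
theorem natCast_mul_formInner (V : Submodule ℝ T) (ε : ℝ) {k : ℕ} {φ : Forms T}
    (hφ : φ ∈ homogeneous T k) (η : Forms T) :
    k * formInner V ε φ η =
      ∑ p, formInner V ε (contraction (stdOrthonormalBasis ℝ Vᗮ p : T) φ)
        (contraction (stdOrthonormalBasis ℝ Vᗮ p : T) η) +
      ε * ∑ q, formInner V ε (contraction (stdOrthonormalBasis ℝ V q : T) φ)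
        (contraction (stdOrthonormalBasis ℝ V q : T) η) := by
  rw [← formInner_smul_left, ← numberOperator_add_numberOperator V k hφ, formInner_add_left,
    numberOperator_apply, numberOperator_apply, formInner_sum_left, formInner_sum_left,
    Finset.mul_sum]
  congr 1
  · exact Finset.sum_congr rfl fun p _ => formInner_wedge_of_mem_orthogonal V ε (Subtype.mem _) _ _
  · exact Finset.sum_congr rfl fun p _ => formInner_wedge_of_mem V ε (Subtype.mem _) _ _

theorem formInner_comm (V : Submodule ℝ T) (ε : ℝ) {k : ℕ} {φ η : Forms T}
    (hφ : φ ∈ homogeneous T k) (hη : η ∈ homogeneous T k) :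
    formInner V ε φ η = formInner V ε η φ := by
  induction k generalizing φ η with
  | zero =>
    obtain ⟨r, rfl⟩ := mem_homogeneous_zero hφ
    obtain ⟨s, rfl⟩ := mem_homogeneous_zero hη
    rw [formInner_algebraMap, formInner_algebraMap, mul_comm]
  | succ k ih =>
    have hk : ((k + 1 : ℕ) : ℝ) ≠ 0 := by positivity
    refine mul_left_cancel₀ hk ?_
    rw [natCast_mul_formInner V ε hφ, natCast_mul_formInner V ε hη]
    congr 2
    · ext p
      exact ih (contraction_mem_homogeneous _ hφ) (contraction_mem_homogeneous _ hη)
    · refine Finset.sum_congr rfl fun p _ => ?_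
      exact ih (contraction_mem_homogeneous _ hφ) (contraction_mem_homogeneous _ hη)

theorem formInner_self_nonneg (V : Submodule ℝ T) {ε : ℝ} (hε : 0 < ε) {k : ℕ} {φ : Forms T}
    (hφ : φ ∈ homogeneous T k) : 0 ≤ formInner V ε φ φ := by
  induction k generalizing φ with
  | zero =>
    obtain ⟨r, rfl⟩ := mem_homogeneous_zero hφ
    rw [formInner_algebraMap]
    exact mul_self_nonneg r
  | succ k ih =>
    have hk : 0 < ((k + 1 : ℕ) : ℝ) := by positivity
    refine nonneg_of_mul_nonneg_right ?_ hk
    rw [natCast_mul_formInner V ε hφ]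
    exact add_nonneg (Finset.sum_nonneg fun p _ => ih (contraction_mem_homogeneous _ hφ))
      (mul_nonneg hε.le (Finset.sum_nonneg fun p _ => ih (contraction_mem_homogeneous _ hφ)))

theorem formInner_contraction (V : Submodule ℝ T) (ε : ℝ) {X : T} (hX : X ∈ Vᗮ) {k : ℕ}
    {φ η : Forms T} (hφ : φ ∈ homogeneous T (k + 1)) (hη : η ∈ homogeneous T k) :
    formInner V ε (contraction X φ) η = formInner V ε φ (wedge X η) := by
  rw [formInner_comm V ε (contraction_mem_homogeneous X hφ) hη,
    ← formInner_wedge_of_mem_orthogonal V ε hX,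
    formInner_comm V ε (wedge_mem_homogeneous X hη) hφ]

/-- Nonnegativity on linear combinations says that the Gram matrix is positive semidefinite; its
rank-one decomposition replaces the form-valued coefficients by real ones. -/
theorem exists_formInner_eq_sum (V : Submodule ℝ T) {ε : ℝ} (hε : 0 < ε) {k : ℕ} {κ : Type*}
    [Fintype κ] (φ : κ → Forms T) (hφ : ∀ l, φ l ∈ homogeneous T k) :
    ∃ (r : ℕ) (f : Fin r → κ → ℝ),
      ∀ l l', formInner V ε (φ l) (φ l') = ∑ t, f t l * f t l' := by
  have h : (Matrix.of fun l l' => formInner V ε (φ l) (φ l')).PosSemidef := by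
    classical
    refine Matrix.PosSemidef.of_dotProduct_mulVec_nonneg ?_ fun x => ?_
    · ext l l'
      simpa using formInner_comm V ε (hφ l') (hφ l)
    · have := formInner_self_nonneg V hε
        (Submodule.sum_mem _ fun l (_ : l ∈ Finset.univ) => Submodule.smul_mem _ (x l) (hφ l))
      simp only [formInner_sum_left, formInner_sum_right, formInner_smul_left,
        formInner_smul_right] at this
      simp only [Finset.mul_sum] at this
      rw [Finset.sum_comm] at this
      simpa [dotProduct, Matrix.mulVec, Finset.mul_sum, mul_left_comm, mul_comm] using this
  obtain ⟨r, f, hf⟩ := Matrix.posSemidef_iff_eq_sum_vecMulVec.1 h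
  refine ⟨r, f, fun l l' => ?_⟩
  have := congrFun (congrFun hf l) l'
  simpa [Matrix.sum_apply, Matrix.vecMulVec_apply] using this

end Fermions

/-! ### Algebraic curvature tensors and the Weitzenböck operator -/

section Curvature

variable {T : Type*} [NormedAddCommGroup T] [InnerProductSpace ℝ T]

/-- `S` has the algebraic symmetries of the curvature tensor of a metric and torsion-free
connection, with values in `Vᗮ`. -/
structure IsTransverseCurvature (V : Submodule ℝ T) (S : T → T → T → T) : Prop where
  mem : ∀ u v w, S u v w ∈ Vᗮ
  skew : ∀ u v w, S u v w = -S v u w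
  inner_skew : ∀ u v w z, inner ℝ (S u v w) z = -inner ℝ (S u v z) w
  bianchi : ∀ u v w, S u v w + S v w u + S w u v = 0

namespace IsTransverseCurvature

variable {V : Submodule ℝ T} {S : T → T → T → T} (h : IsTransverseCurvature V S)

include h

theorem inner_swap (u v w z : T) : inner ℝ (S u v w) z = -inner ℝ (S v u w) z := by
  rw [h.skew u v w, inner_neg_left]

theorem inner_bianchi (u v w z : T) :
    inner ℝ (S u v w) z + inner ℝ (S v w u) z + inner ℝ (S w u v) z = 0 := by
  rw [← inner_add_left, ← inner_add_left, h.bianchi, inner_zero_left]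

/-- The classical octahedron argument: combine the four cyclic Bianchi identities in u, v, w, z and
cancel by the two skew-symmetries. No linearity of `S` is used. -/
theorem inner_pair_comm (u v w z : T) : inner ℝ (S u v w) z = inner ℝ (S w z u) v := by
  have b₁ := h.inner_bianchi u v w z
  have b₂ := h.inner_bianchi v w z u
  have b₃ := h.inner_bianchi w z u v
  have b₄ := h.inner_bianchi z u v w
  have s₁ := h.inner_skew u v w z
  have s₂ := h.inner_skew v w u z
  have s₃ := h.inner_skew w u v z
  have s₄ := h.inner_skew w z v u
  have s₅ := h.inner_skew z v w u
  have s₆ := h.inner_skew z u w v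
  have t₁ := h.inner_swap z v w u
  have t₂ := h.inner_swap w u z v
  have t₃ := h.inner_swap u v z w
  have t₄ := h.inner_swap v z u w
  have t₅ := h.inner_swap v w u z
  have t₆ := h.inner_swap z u w v
  have t₇ := h.inner_swap w u v z
  have t₈ := h.inner_swap v z w u
  have s₇ := h.inner_skew v z w u
  have s₈ := h.inner_skew u z w v
  linarith

/-- Pair symmetry moves `v` out of the argument of `S` into the inner product, where linearity is
free. -/
theorem map_add_middle (u v v' w : T) : S u (v + v') w = S u v w + S u v' w :=
  ext_inner_right ℝ fun z => by
    rw [inner_add_left, h.inner_pair_comm, inner_add_right, h.inner_pair_comm u v,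
      h.inner_pair_comm u v']

theorem map_smul_middle (u : T) (r : ℝ) (v w : T) : S u (r • v) w = r • S u v w :=
  ext_inner_right ℝ fun z => by
    rw [real_inner_smul_left, h.inner_pair_comm, real_inner_smul_right, h.inner_pair_comm u v]

theorem map_add_left (u u' v w : T) : S (u + u') v w = S u v w + S u' v w := by
  rw [h.skew, h.map_add_middle, h.skew u, h.skew u', neg_add]

theorem map_smul_left (r : ℝ) (u v w : T) : S (r • u) v w = r • S u v w := by
  rw [h.skew, h.map_smul_middle, h.skew u, smul_neg]

/-- After pair symmetry `v` is paired with a value of `S`, which is horizontal. -/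
theorem map_vertical_middle (u w : T) {v : T} (hv : v ∈ V) : S u v w = 0 :=
  ext_inner_right ℝ fun z => by
    rw [h.inner_pair_comm, inner_zero_left, real_inner_comm]
    exact h.mem _ _ _ v hv

theorem map_vertical_left (v w : T) {u : T} (hu : u ∈ V) : S u v w = 0 := by
  rw [h.skew, h.map_vertical_middle v w hu, neg_zero]

end IsTransverseCurvature

variable [FiniteDimensional ℝ T] (V : Submodule ℝ T) (S : T → T → T → T)

theorem horizontalFrame_mem (p : Fin (Module.finrank ℝ Vᗮ)) : horizontalFrame V p ∈ Vᗮ :=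
  Subtype.mem _

theorem inner_horizontalFrame (p q : Fin (Module.finrank ℝ Vᗮ)) :
    inner ℝ (horizontalFrame V p) (horizontalFrame V q) = if p = q then 1 else 0 :=
  orthonormal_iff_ite.1 (stdOrthonormalBasis ℝ Vᗮ).orthonormal p q

theorem sum_inner_smul_horizontalFrame {v : T} (hv : v ∈ Vᗮ) :
    ∑ p, inner ℝ v (horizontalFrame V p) • horizontalFrame V p = v := by
  have h := sum_inner_smul_stdOrthonormalBasis Vᗮ v
  rw [Submodule.starProjection_eq_self_iff.2 hv] at h
  conv_rhs => rw [← h]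
  exact Finset.sum_congr rfl fun p _ => by rw [real_inner_comm]; rfl

/-- A trace does not depend on the orthonormal basis, and a basis adapted to the splitting loses its
vertical part. This reduces the Ricci sums over the whole tangent space to the horizontal frame. -/
theorem sum_stdOrthonormalBasis_eq_sum_horizontalFrame {A : Type*} [AddCommGroup A] [Module ℝ A]
    (B : T →ₗ[ℝ] T →ₗ[ℝ] A) (hB : ∀ u, ∀ v ∈ V, B u v = 0) :
    ∑ a, B (stdOrthonormalBasis ℝ T a) (stdOrthonormalBasis ℝ T a) =
      ∑ p, B (horizontalFrame V p) (horizontalFrame V p) := by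
  have h (a) : B (stdOrthonormalBasis ℝ T a) (stdOrthonormalBasis ℝ T a) =
      ∑ p, inner ℝ (stdOrthonormalBasis ℝ T a) (horizontalFrame V p) •
        B (stdOrthonormalBasis ℝ T a) (horizontalFrame V p) := by
    set e := stdOrthonormalBasis ℝ T a
    have h₁ : B e e = B e (Vᗮ.starProjection e) := by
      rw [Submodule.starProjection_orthogonal', _root_.sub_apply, map_sub,
        hB _ _ (Submodule.starProjection_apply_mem V e), sub_zero]
      rfl
    rw [h₁, ← sum_inner_smul_stdOrthonormalBasis, map_sum]
    exact Finset.sum_congr rfl fun p _ => by rw [map_smul, real_inner_comm]; rfl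
  simp_rw [h]
  rw [Finset.sum_comm]
  refine Finset.sum_congr rfl fun p _ => ?_
  conv_rhs =>
    enter [1]
    rw [← (stdOrthonormalBasis ℝ T).sum_repr (horizontalFrame V p)]
  rw [map_sum, LinearMap.sum_apply]
  exact Finset.sum_congr rfl fun a _ => by
    rw [map_smul, LinearMap.smul_apply, OrthonormalBasis.repr_apply_apply]

/-- The components `⟨S(X_p, X_q) X_s, X_r⟩` of a curvature tensor in the horizontal frame. -/
def curvatureComponent (p q r s : Fin (Module.finrank ℝ Vᗮ)) : ℝ :=
  inner ℝ (S (horizontalFrame V p) (horizontalFrame V q) (horizontalFrame V s))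
    (horizontalFrame V r)

theorem multiContraction_ricciTwoBivector (v w : T) (φ : Forms T) :
    multiContraction (ricciTwoBivector V S v w) φ =
      ∑ p, contraction (S v w (horizontalFrame V p)) (contraction (horizontalFrame V p) φ) := by
  simp [ricciTwoBivector, multiContraction_ι_mul_ι]

variable {V S} (h : IsTransverseCurvature V S)

include h

theorem curvatureComponent_swap (p q r s : Fin (Module.finrank ℝ Vᗮ)) :
    curvatureComponent V S p q r s = -curvatureComponent V S q p r s :=
  h.inner_swap _ _ _ _

theorem curvatureComponent_skew (p q r s : Fin (Module.finrank ℝ Vᗮ)) :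
    curvatureComponent V S p q r s = -curvatureComponent V S p q s r :=
  h.inner_skew _ _ _ _

theorem curvatureComponent_bianchi (i j k l : Fin (Module.finrank ℝ Vᗮ)) :
    curvatureComponent V S i j k l =
      curvatureComponent V S j k l i - curvatureComponent V S i k l j := by
  have h₁ := curvatureComponent_skew h i j k l
  have h₂ := curvatureComponent_swap h i k l j
  have h₃ := h.inner_bianchi (horizontalFrame V i) (horizontalFrame V j) (horizontalFrame V k)
    (horizontalFrame V l)
  simp only [curvatureComponent] at *
  linarith

theorem curvature_horizontalFrame (p q s : Fin (Module.finrank ℝ Vᗮ)) :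
    S (horizontalFrame V p) (horizontalFrame V q) (horizontalFrame V s) =
      ∑ r, curvatureComponent V S p q r s • horizontalFrame V r :=
  (sum_inner_smul_horizontalFrame V (h.mem _ _ _)).symm

theorem ricciOneVector_add (v v' : T) :
    ricciOneVector V S (v + v') = ricciOneVector V S v + ricciOneVector V S v' := by
  simp only [ricciOneVector, h.map_add_middle, Finset.sum_add_distrib, neg_add]

theorem ricciOneVector_smul (r : ℝ) (v : T) :
    ricciOneVector V S (r • v) = r • ricciOneVector V S v := by
  simp only [ricciOneVector, h.map_smul_middle, ← Finset.smul_sum, smul_neg]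

theorem ricciOneVector_vertical {v : T} (hv : v ∈ V) : ricciOneVector V S v = 0 := by
  simp [ricciOneVector, h.map_vertical_middle _ _ hv]

theorem fermion_ricciOne (φ : Forms T) :
    fermion (ricciOne V S) φ =
      ∑ p, wedge (horizontalFrame V p)
        (contraction (ricciOneVector V S (horizontalFrame V p)) φ) := by
  have := sum_stdOrthonormalBasis_eq_sum_horizontalFrame V
    (LinearMap.mk₂ ℝ (fun x v => wedge x (contraction (ricciOneVector V S v) φ))
      (by simp) (by simp) (by simp [ricciOneVector_add h]) (by simp [ricciOneVector_smul h]))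
    (by simp +contextual [ricciOneVector_vertical h])
  simp only [LinearMap.mk₂_apply] at this
  rw [← this, ricciOne, map_sum, LinearMap.sum_apply]
  exact Finset.sum_congr rfl fun a _ => by rw [fermion_tmul, multiContraction_ι]; rfl

theorem fermion_ricciTwo (φ : Forms T) :
    fermion (ricciTwo V S) φ =
      (1 / 2 : ℝ) • ∑ a, ∑ b, wedge (horizontalFrame V a) (wedge (horizontalFrame V b)
        (∑ p, contraction (S (horizontalFrame V a) (horizontalFrame V b) (horizontalFrame V p))
          (contraction (horizontalFrame V p) φ))) := by
  have h₁ (x v : T) := sum_stdOrthonormalBasis_eq_sum_horizontalFrame V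
    (LinearMap.mk₂ ℝ (fun y w => wedge x (wedge y
        (∑ p, contraction (S v w (horizontalFrame V p)) (contraction (horizontalFrame V p) φ))))
      (by simp [Finset.sum_add_distrib]) (by simp [Finset.smul_sum])
      (by simp [h.map_add_middle, Finset.sum_add_distrib])
      (by simp [h.map_smul_middle, Finset.smul_sum]))
    (by simp +contextual [h.map_vertical_middle])
  have h₂ := sum_stdOrthonormalBasis_eq_sum_horizontalFrame V
    (LinearMap.mk₂ ℝ (fun x v => ∑ b, wedge x (wedge (horizontalFrame V b)
        (∑ p, contraction (S v (horizontalFrame V b) (horizontalFrame V p))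
          (contraction (horizontalFrame V p) φ))))
      (by simp [Finset.sum_add_distrib]) (by simp [Finset.smul_sum])
      (by simp [h.map_add_left, Finset.sum_add_distrib])
      (by simp [h.map_smul_left, Finset.smul_sum]))
    (by simp +contextual [h.map_vertical_left])
  simp only [LinearMap.mk₂_apply] at h₁ h₂
  rw [← h₂, ricciTwo, map_smul, LinearMap.smul_apply, map_sum, LinearMap.sum_apply]
  congr 1
  refine Finset.sum_congr rfl fun a _ => ?_
  rw [← h₁, map_sum, LinearMap.sum_apply]
  refine Finset.sum_congr rfl fun b _ => ?_
  rw [fermion_tmul, multiContraction_ricciTwoBivector, mul_assoc]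
  rfl

/-- The right-hand side is not normally ordered: moving the inner contraction past the inner wedge
yields a quadratic term, which is Ric_{1,1}, and a quartic term, which is Ric_{2,2} by the Bianchi
identity. -/
theorem ricciOperator_apply (φ : Forms T) :
    ricciOperator V S φ = ∑ a, ∑ b, ∑ r, ∑ s, curvatureComponent V S a b r s •
      wedge (horizontalFrame V a) (contraction (horizontalFrame V b)
        (wedge (horizontalFrame V s) (contraction (horizontalFrame V r) φ))) := by
  set X := horizontalFrame V
  set K := curvatureComponent V S
  have e₁ : fermion (ricciOne V S) φ = ∑ a, ∑ b, ∑ r, K a b r b • wedge (X a) (contraction (X r) φ) := by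
    rw [fermion_ricciOne h]
    refine Finset.sum_congr rfl fun a _ => ?_
    have : ricciOneVector V S (X a) = ∑ b, ∑ r, K a b r b • X r := by
      rw [ricciOneVector, ← Finset.sum_neg_distrib]
      refine Finset.sum_congr rfl fun b _ => ?_
      rw [← h.skew, curvature_horizontalFrame h]
    change wedge (X a) (contraction (ricciOneVector V S (X a)) φ) = _
    rw [this]
    simp only [map_sum, map_smul, LinearMap.sum_apply, LinearMap.smul_apply]
  have e₂ : fermion (ricciTwo V S) φ = (1 / 2 : ℝ) • ∑ i, ∑ j, ∑ k, ∑ l, K i j k l •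
      wedge (X i) (wedge (X j) (contraction (X k) (contraction (X l) φ))) := by
    rw [fermion_ricciTwo h]
    congr 1
    refine Finset.sum_congr rfl fun i _ => Finset.sum_congr rfl fun j _ => ?_
    simp only [X, curvature_horizontalFrame h, map_sum, map_smul, LinearMap.sum_apply,
      LinearMap.smul_apply]
    rw [Finset.sum_comm]
  -- Bianchi writes K_{ijkl} as K_{jkli} - K_{iklj}. Exchanging i and j in the first sum and
  -- anticommuting the wedges shows that both halves are equal; the resulting factor -2 cancels the
  -- 1/2 in Ric_{2,2}.
  have e₃ : ∑ i, ∑ j, ∑ k, ∑ l, K i j k l •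
      wedge (X i) (wedge (X j) (contraction (X k) (contraction (X l) φ))) =
      (-2 : ℝ) • ∑ i, ∑ j, ∑ k, ∑ l, K i k l j •
      wedge (X i) (wedge (X j) (contraction (X k) (contraction (X l) φ))) := by
    have : ∑ i, ∑ j, ∑ k, ∑ l, K j k l i •
        wedge (X i) (wedge (X j) (contraction (X k) (contraction (X l) φ))) =
        -∑ i, ∑ j, ∑ k, ∑ l, K i k l j •
        wedge (X i) (wedge (X j) (contraction (X k) (contraction (X l) φ))) := by
      rw [Finset.sum_comm]
      simp only [← Finset.sum_neg_distrib]
      refine Finset.sum_congr rfl fun i _ => Finset.sum_congr rfl fun j _ =>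
        Finset.sum_congr rfl fun k _ => Finset.sum_congr rfl fun l _ => ?_
      rw [wedge_comm (X j), smul_neg]
    have hK (i j k l) : K i j k l = K j k l i - K i k l j := curvatureComponent_bianchi h i j k l
    conv_lhs =>
      enter [2, i, 2, j, 2, k, 2, l]
      rw [hK i j k l, sub_smul]
    simp only [Finset.sum_sub_distrib]
    rw [this, neg_smul, two_smul, neg_add, sub_eq_add_neg]
  have e₄ (a b r s) : K a b r s •
      wedge (X a) (contraction (X b) (wedge (X s) (contraction (X r) φ))) =
      (if s = b then K a b r s • wedge (X a) (contraction (X r) φ) else 0) -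
        K a b r s • wedge (X a) (wedge (X s) (contraction (X b) (contraction (X r) φ))) := by
    rw [contraction_wedge, map_sub, smul_sub, map_smul, inner_horizontalFrame]
    split_ifs <;> simp
  rw [ricciOperator, map_add, LinearMap.add_apply, e₁, e₂, e₃, smul_smul]
  simp only [e₄, Finset.sum_sub_distrib, Finset.sum_ite_eq', Finset.mem_univ,
    if_true]
  norm_num
  rw [sub_eq_add_neg, add_right_inj, neg_inj]
  refine Finset.sum_congr rfl fun a _ => ?_
  rw [Finset.sum_comm]
  exact Finset.sum_congr rfl fun b _ => Finset.sum_comm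

end Curvature

/-! ### The lower bound for the Weitzenböck operator -/

section Weitzenbock

variable {T : Type*} [NormedAddCommGroup T] [InnerProductSpace ℝ T] [FiniteDimensional ℝ T]
  {V : Submodule ℝ T} {S : T → T → T → T}

theorem contraction_numberOperator_horizontal (a : Fin (Module.finrank ℝ Vᗮ)) (φ : Forms T) :
    numberOperator Vᗮ (contraction (horizontalFrame V a) φ) =
      contraction (horizontalFrame V a) (numberOperator Vᗮ φ) -
        contraction (horizontalFrame V a) φ := by
  have key (p : Fin (Module.finrank ℝ Vᗮ)) :
      wedge (horizontalFrame V p)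
        (contraction (horizontalFrame V p) (contraction (horizontalFrame V a) φ)) =
      contraction (horizontalFrame V a)
        (wedge (horizontalFrame V p) (contraction (horizontalFrame V p) φ)) -
      (if p = a then contraction (horizontalFrame V p) φ else 0) := by
    rw [contraction_comm, map_neg, contraction_wedge, inner_horizontalFrame]
    split_ifs <;> simp
  have := Finset.sum_congr rfl fun p (_ : p ∈ Finset.univ) => key p
  rw [Finset.sum_sub_distrib, Finset.sum_ite_eq' , if_pos (Finset.mem_univ _), ← map_sum] at this
  rw [numberOperator_apply, numberOperator_apply]
  exact this

theorem sum_contraction_wedge (φ : Forms T) :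
    ∑ b, contraction (horizontalFrame V b) (wedge (horizontalFrame V b) φ) =
      (Module.finrank ℝ Vᗮ : ℝ) • φ - numberOperator Vᗮ φ := by
  simp only [contraction_wedge, inner_horizontalFrame, Finset.sum_sub_distrib, numberOperator_apply]
  simp [← Nat.cast_smul_eq_nsmul ℝ]
  rfl

theorem sum_contraction_wedge_contraction (a : Fin (Module.finrank ℝ Vᗮ)) (φ : Forms T) :
    ∑ b, contraction (horizontalFrame V b) (wedge (horizontalFrame V a)
      (contraction (horizontalFrame V b) φ)) = contraction (horizontalFrame V a) φ := by
  have key (b : Fin (Module.finrank ℝ Vᗮ)) :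
      contraction (horizontalFrame V b) (contraction (horizontalFrame V b) φ) = 0 := by
    rw [← Module.End.mul_apply, contraction_mul_self, LinearMap.zero_apply]
  simp [contraction_wedge, inner_horizontalFrame, key]

theorem sum_formInner_contraction (ε : ℝ) (φ η : Forms T) :
    ∑ a, formInner V ε (contraction (horizontalFrame V a) φ)
      (contraction (horizontalFrame V a) η) = formInner V ε (numberOperator Vᗮ φ) η := by
  rw [numberOperator_apply, formInner_sum_left]
  exact Finset.sum_congr rfl fun a _ =>
    (formInner_wedge_of_mem_orthogonal V ε (horizontalFrame_mem V a) _ _).symm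

/-- For fixed a, move the outer wedge to the right. The diagonal terms give n - N on ι_{X_a} α,
where N = i - 1, that is n - i + 1, and the crossed terms subtract 1. The sum over a of ‖ι_{X_a} α‖²
then gives the factor i. -/
theorem sum_formInner_rotation (ε : ℝ) {i j : ℕ} {α : Forms T}
    (hα : α ∈ bidegree V i j) :
    ∑ a, ∑ b, (formInner V ε
        (wedge (horizontalFrame V b) (contraction (horizontalFrame V a) α))
        (wedge (horizontalFrame V b) (contraction (horizontalFrame V a) α)) -
      formInner V ε
        (wedge (horizontalFrame V b) (contraction (horizontalFrame V a) α))
        (wedge (horizontalFrame V a) (contraction (horizontalFrame V b) α))) =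
      i * ((Module.finrank ℝ Vᗮ : ℝ) - i) * formInner V ε α α := by
  have h₁ (a : Fin (Module.finrank ℝ Vᗮ)) : ∑ b, (formInner V ε
        (wedge (horizontalFrame V b) (contraction (horizontalFrame V a) α))
        (wedge (horizontalFrame V b) (contraction (horizontalFrame V a) α)) -
      formInner V ε
        (wedge (horizontalFrame V b) (contraction (horizontalFrame V a) α))
        (wedge (horizontalFrame V a) (contraction (horizontalFrame V b) α))) =
      ((Module.finrank ℝ Vᗮ : ℝ) - i) * formInner V ε (contraction (horizontalFrame V a) α)
        (contraction (horizontalFrame V a) α) := by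
    have hN := contraction_numberOperator_horizontal a α
    rw [numberOperator_orthogonal_bidegree V i j hα, map_smul] at hN
    simp only [formInner_wedge_of_mem_orthogonal V ε (horizontalFrame_mem V _)]
    rw [Finset.sum_sub_distrib, ← formInner_sum_right, ← formInner_sum_right,
      sum_contraction_wedge, sum_contraction_wedge_contraction, hN]
    simp only [← formInnerₗ_apply, map_sub, map_smul, smul_eq_mul]
    ring
  rw [Finset.sum_congr rfl fun a _ => h₁ a, ← Finset.mul_sum, sum_formInner_contraction,
    numberOperator_orthogonal_bidegree V i j hα, formInner_smul_left]
  ring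

theorem formInner_one_eq (ε : ℝ) (η : Forms T) :
    formInner V ε 1 η = ExteriorAlgebra.algebraMapInv η := by
  simp [formInner, multiContraction_one]

theorem formInner_wedge_wedge_one (ε : ℝ) (r s : Fin (Module.finrank ℝ Vᗮ)) (η : Forms T) :
    formInner V ε (wedge (horizontalFrame V r) (wedge (horizontalFrame V s) 1)) η =
      ExteriorAlgebra.algebraMapInv
        (contraction (horizontalFrame V s) (contraction (horizontalFrame V r) η)) := by
  rw [formInner_wedge_of_mem_orthogonal V ε (horizontalFrame_mem V r),
    formInner_wedge_of_mem_orthogonal V ε (horizontalFrame_mem V s), formInner_one_eq]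

theorem wedge_wedge_one_mem_bidegree (r s : Fin (Module.finrank ℝ Vᗮ)) :
    wedge (horizontalFrame V r) (wedge (horizontalFrame V s) 1) ∈ bidegree V 2 0 := by
  have h (p) : ExteriorAlgebra.ι ℝ (flat (horizontalFrame V p)) ∈
      V.dualAnnihilator.map (ExteriorAlgebra.ι ℝ) := by
    refine Submodule.mem_map_of_mem ((Submodule.mem_dualAnnihilator _).2 fun v hv => ?_)
    exact (Submodule.mem_orthogonal' _ _).1 (horizontalFrame_mem V p) v hv
  rw [bidegree, pow_zero, mul_one, pow_two, wedge_apply, wedge_apply, mul_one]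
  exact Submodule.mul_mem_mul (h r) (h s)

theorem algebraMapInv_contraction_contraction (p q a b : Fin (Module.finrank ℝ Vᗮ)) :
    ExteriorAlgebra.algebraMapInv (contraction (horizontalFrame V q)
      (contraction (horizontalFrame V p)
        (wedge (horizontalFrame V a) (wedge (horizontalFrame V b) (1 : Forms T))))) =
      (if a = p then if b = q then 1 else 0 else 0) -
        (if b = p then if a = q then 1 else 0 else 0) := by
  have h₁ (X : T) : contraction X (1 : Forms T) = 0 := by
    simpa using contraction_algebraMap X 1
  rw [contraction_wedge, contraction_wedge, h₁, map_zero, sub_zero, map_sub, map_smul,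
    contraction_wedge, h₁, map_zero, sub_zero, map_smul, map_smul, contraction_wedge, h₁, map_zero,
    sub_zero]
  simp only [inner_horizontalFrame, map_sub, map_smul, map_one, smul_eq_mul]
  split_ifs <;> simp

/-- A lower bound of the horizontal curvature operator, in the horizontal frame. -/
theorem le_sum_curvatureComponent (h : IsTransverseCurvature V S) {c : ℝ}
    (hR : ∀ φ ∈ bidegree V 2 0,
      c * formInner V 1 φ φ ≤ formInner V 1 (curvatureOperator V S φ) φ)
    (f : Fin (Module.finrank ℝ Vᗮ) → Fin (Module.finrank ℝ Vᗮ) → ℝ) :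
    c * ∑ a, ∑ b, f a b * (f a b - f b a) ≤
      ∑ a, ∑ b, ∑ r, ∑ s, curvatureComponent V S a b r s * f a b * f r s := by
  -- The coefficients `f` are not assumed antisymmetric, since those coming from the Gram matrix are
  -- not; the two-form φ sees only their antisymmetric part.
  set φ : Forms T := ∑ a, ∑ b, f a b • wedge (horizontalFrame V a) (wedge (horizontalFrame V b) 1)
    with hφ
  have hmem : φ ∈ bidegree V 2 0 := Submodule.sum_mem _ fun a _ => Submodule.sum_mem _ fun b _ =>
    Submodule.smul_mem _ _ (wedge_wedge_one_mem_bidegree a b)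
  have hval (p q) : ExteriorAlgebra.algebraMapInv
      (contraction (horizontalFrame V q) (contraction (horizontalFrame V p) φ)) =
      f p q - f q p := by
    simp only [hφ, map_sum, map_smul, algebraMapInv_contraction_contraction, smul_eq_mul, mul_sub,
      mul_ite, mul_one, mul_zero, Finset.sum_sub_distrib]
    congr 1
    · simp [Finset.sum_ite_irrel]
    · simp
  have hleft : formInner V 1 φ φ = ∑ a, ∑ b, f a b * (f a b - f b a) := by
    conv_lhs =>
      enter [3]
      rw [hφ]
    simp only [formInner_sum_left, formInner_smul_left, formInner_wedge_wedge_one, hval]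
  have hcurv : curvatureOperator V S φ = ∑ p, ∑ q, ∑ r, ∑ s,
      ((1 / 4 : ℝ) * (f p q - f q p) * curvatureComponent V S p q r s) •
        wedge (horizontalFrame V r) (wedge (horizontalFrame V s) 1) := by
    simp only [curvatureOperator, hval, curvatureComponent, wedge_apply, mul_one]
  have hright : formInner V 1 (curvatureOperator V S φ) φ =
      ∑ a, ∑ b, ∑ r, ∑ s, (1 / 4 : ℝ) * (f a b - f b a) * curvatureComponent V S a b r s *
        (f r s - f s r) := by
    simp only [hcurv, formInner_sum_left, formInner_smul_left, formInner_wedge_wedge_one, hval]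
  -- Each antisymmetrisation of `f` against a skew pair of indices of the curvature gives a factor
  -- 2; the two factors cancel the 1/4 in `curvatureOperator`.
  have h₁ (a b) : ∑ r, ∑ s, curvatureComponent V S a b r s * (f r s - f s r) =
      2 * ∑ r, ∑ s, curvatureComponent V S a b r s * f r s := by
    have : ∑ r, ∑ s, curvatureComponent V S a b r s * f s r =
        -∑ r, ∑ s, curvatureComponent V S a b r s * f r s := by
      rw [Finset.sum_comm]
      simp only [← Finset.sum_neg_distrib]
      exact Finset.sum_congr rfl fun r _ => Finset.sum_congr rfl fun s _ => by
        rw [curvatureComponent_skew h, neg_mul]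
    simp only [mul_sub, Finset.sum_sub_distrib, this]
    ring
  set k := fun a b => ∑ r, ∑ s, curvatureComponent V S a b r s * f r s with hk
  have hk_swap (a b) : k a b = -k b a := by
    simp only [hk, ← Finset.sum_neg_distrib]
    exact Finset.sum_congr rfl fun r _ => Finset.sum_congr rfl fun s _ => by
      rw [curvatureComponent_swap h, neg_mul]
  have h₂ : ∑ a, ∑ b, (f a b - f b a) * k a b = 2 * ∑ a, ∑ b, f a b * k a b := by
    have : ∑ a, ∑ b, f b a * k a b = -∑ a, ∑ b, f a b * k a b := by
      rw [Finset.sum_comm]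
      simp only [← Finset.sum_neg_distrib]
      exact Finset.sum_congr rfl fun r _ => Finset.sum_congr rfl fun s _ => by
        rw [hk_swap, mul_neg]
    simp only [sub_mul, Finset.sum_sub_distrib, this]
    ring
  have h₃ : formInner V 1 (curvatureOperator V S φ) φ = ∑ a, ∑ b, f a b * k a b := by
    have : formInner V 1 (curvatureOperator V S φ) φ =
        (1 / 2 : ℝ) * ∑ a, ∑ b, (f a b - f b a) * k a b := by
      rw [hright, Finset.mul_sum]
      refine Finset.sum_congr rfl fun a _ => ?_
      rw [Finset.mul_sum]
      refine Finset.sum_congr rfl fun b _ => ?_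
      have := h₁ a b
      simp only [mul_assoc, ← Finset.mul_sum]
      rw [this]
      ring
    rw [this, h₂]
    ring
  have := hR φ hmem
  rw [hleft, h₃] at this
  refine this.trans (le_of_eq ?_)
  simp only [hk, Finset.mul_sum]
  exact Finset.sum_congr rfl fun a _ => Finset.sum_congr rfl fun b _ =>
    Finset.sum_congr rfl fun r _ => Finset.sum_congr rfl fun s _ => by ring

/-- The outer ♭X_a ∧ ι_{X_b} is moved to the other argument, where its adjoint ♭X_b ∧ ι_{X_a} acts
on α. The identity is thus a quadratic form of the curvature in Gram coefficients. -/
theorem formInner_ricciOperator (h : IsTransverseCurvature V S) (ε : ℝ) {k : ℕ} {α : Forms T}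
    (hα : α ∈ homogeneous T (k + 1)) :
    formInner V ε (ricciOperator V S α) α = ∑ a, ∑ b, ∑ r, ∑ s,
      curvatureComponent V S a b r s *
        formInner V ε (wedge (horizontalFrame V b) (contraction (horizontalFrame V a) α))
          (wedge (horizontalFrame V s) (contraction (horizontalFrame V r) α)) := by
  have hc (p) : contraction (horizontalFrame V p) α ∈ homogeneous T k :=
    contraction_mem_homogeneous _ hα
  rw [ricciOperator_apply h]
  simp only [formInner_sum_left, formInner_smul_left]
  refine Finset.sum_congr rfl fun a _ => Finset.sum_congr rfl fun b _ =>
    Finset.sum_congr rfl fun r _ => Finset.sum_congr rfl fun s _ => ?_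
  rw [formInner_wedge_of_mem_orthogonal V ε (horizontalFrame_mem V a),
    formInner_contraction V ε (horizontalFrame_mem V b) (wedge_mem_homogeneous _ (hc r)) (hc a),
    formInner_comm V ε (wedge_mem_homogeneous _ (hc r)) (wedge_mem_homogeneous _ (hc a))]

/-- If the horizontal curvature operator is bounded below by `c > 0`, then so is the
Weitzenböck operator on forms of bidegree `(i, j)` for `i ≠ 0, n`. -/
theorem le_formInner_ricciOperator (h : IsTransverseCurvature V S) {c : ℝ} (hc : 0 < c)
    (hR : ∀ φ ∈ bidegree V 2 0,
      c * formInner V 1 φ φ ≤ formInner V 1 (curvatureOperator V S φ) φ)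
    {i j : ℕ} (hi : i ≠ 0) (hin : i ≠ Module.finrank ℝ Vᗮ) {α : Forms T}
    (hα : α ∈ bidegree V i j) {ε : ℝ} (hε : 0 < ε) :
    c * formInner V ε α α ≤ formInner V ε (ricciOperator V S α) α := by
  obtain ⟨k, hk⟩ : ∃ k, i + j = k + 1 := ⟨i + j - 1, by omega⟩
  have hhom : α ∈ homogeneous T (k + 1) := hk ▸ bidegree_le_homogeneous V i j hα
  have hvec (l : Fin (Module.finrank ℝ Vᗮ) × Fin (Module.finrank ℝ Vᗮ)) :
      wedge (horizontalFrame V l.2) (contraction (horizontalFrame V l.1) α) ∈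
        homogeneous T (k + 1) :=
    wedge_mem_homogeneous _ (contraction_mem_homogeneous _ hhom)
  obtain ⟨r, f, hf⟩ := exists_formInner_eq_sum V hε _ hvec
  have hf' (a b a' b') := hf (a, b) (a', b')
  simp only at hf'
  have hrot := sum_formInner_rotation ε hα
  have hgram : ∑ t, ∑ a, ∑ b, f t (a, b) * (f t (a, b) - f t (b, a)) =
      i * ((Module.finrank ℝ Vᗮ : ℝ) - i) * formInner V ε α α := by
    rw [← hrot, Finset.sum_comm]
    refine Finset.sum_congr rfl fun a _ => ?_
    rw [Finset.sum_comm]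
    refine Finset.sum_congr rfl fun b _ => ?_
    rw [hf', hf', ← Finset.sum_sub_distrib]
    exact Finset.sum_congr rfl fun t _ => mul_sub _ _ _
  have hric : formInner V ε (ricciOperator V S α) α = ∑ t, ∑ a, ∑ b, ∑ r, ∑ s,
      curvatureComponent V S a b r s * f t (a, b) * f t (r, s) := by
    rw [formInner_ricciOperator h ε hhom, Finset.sum_comm]
    simp only [hf', Finset.mul_sum]
    rw [Finset.sum_comm]
    symm
    rw [Finset.sum_comm]
    refine Finset.sum_congr rfl fun a _ => ?_
    rw [Finset.sum_comm]
    refine Finset.sum_congr rfl fun b _ => ?_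
    rw [Finset.sum_comm]
    refine Finset.sum_congr rfl fun r _ => ?_
    rw [Finset.sum_comm]
    refine Finset.sum_congr rfl fun s _ => ?_
    exact Finset.sum_congr rfl fun t _ => by ring
  have hbound : c * (i * ((Module.finrank ℝ Vᗮ : ℝ) - i) * formInner V ε α α) ≤
      formInner V ε (ricciOperator V S α) α := by
    rw [← hgram, hric, Finset.mul_sum]
    exact Finset.sum_le_sum fun t _ => le_sum_curvatureComponent h hR fun a b => f t (a, b)
  -- This is the sum of the ‖φ_t‖². Its sign is needed only for i > n.
  have hpos : 0 ≤ i * ((Module.finrank ℝ Vᗮ : ℝ) - i) * formInner V ε α α := by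
    rw [← hgram]
    refine Finset.sum_nonneg fun t _ => ?_
    have : ∑ a, ∑ b, f t (a, b) * (f t (a, b) - f t (b, a)) =
        (1 / 2 : ℝ) * ∑ a, ∑ b, (f t (a, b) - f t (b, a)) ^ 2 := by
      have hsymm : ∑ a, ∑ b, f t (b, a) * (f t (a, b) - f t (b, a)) =
          -∑ a, ∑ b, f t (a, b) * (f t (a, b) - f t (b, a)) := by
        rw [Finset.sum_comm]
        simp only [← Finset.sum_neg_distrib]
        exact Finset.sum_congr rfl fun a _ => Finset.sum_congr rfl fun b _ => by ring
      simp only [pow_two, sub_mul (f t (_, _)) (f t (_, _)) (_ - _), Finset.sum_sub_distrib, hsymm]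
      ring
    rw [this]
    exact mul_nonneg (by norm_num)
      (Finset.sum_nonneg fun a _ => Finset.sum_nonneg fun b _ => sq_nonneg _)
  have hnonneg : 0 ≤ formInner V ε α α := formInner_self_nonneg V hε hhom
  have hi' : (1 : ℝ) ≤ i := by exact_mod_cast Nat.one_le_iff_ne_zero.2 hi
  rcases lt_or_gt_of_ne hin with hlt | hgt
  · have hlt' : (i : ℝ) + 1 ≤ Module.finrank ℝ Vᗮ := by exact_mod_cast hlt
    refine le_trans (mul_le_mul_of_nonneg_left ?_ hc.le) hbound
    refine le_mul_of_one_le_left hnonneg ?_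
    nlinarith
  -- For i > n the factor i(n - i) is negative while its product with ‖α‖² is nonnegative, so ‖α‖² =
  -- 0 and the bound is trivial.
  · have hgt' : (Module.finrank ℝ Vᗮ : ℝ) + 1 ≤ i := by exact_mod_cast hgt
    have hzero : formInner V ε α α = 0 := by
      refine le_antisymm ?_ hnonneg
      have : i * ((Module.finrank ℝ Vᗮ : ℝ) - i) ≤ -1 := by nlinarith
      nlinarith
    rw [hzero, mul_zero, mul_zero] at hbound
    rwa [hzero, mul_zero]

end Weitzenbock

/-! ### Smooth vector fields and derivatives along them -/

section SmoothFields

variable {E : Type*} [NormedAddCommGroup E] [NormedSpace ℝ E]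
  {M : Type*} [TopologicalSpace M] [ChartedSpace E M]
  {U U' : Set M} {X Y Z : VecField E M} {f g : M → ℝ} {x : M}

/-- The derivative `X f` of a function along a vector field. -/
def lieDeriv (X : VecField E M) (f : M → ℝ) (x : M) : ℝ := mvfderiv 𝓘(ℝ, E) f x (X x)

theorem mdifferentiableAt_of_contMDiffOn (hf : ContMDiffOn 𝓘(ℝ, E) 𝓘(ℝ, ℝ) ∞ f U) (hU : IsOpen U)
    (hx : x ∈ U) : MDifferentiableAt 𝓘(ℝ, E) 𝓘(ℝ, ℝ) f x :=
  (ContMDiffOn.contMDiffAt hf (hU.mem_nhds hx)).mdifferentiableAt (by simp)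

theorem lieDeriv_congr (hU : IsOpen U) (hx : x ∈ U) (h : ∀ y ∈ U, f y = g y) :
    lieDeriv X f x = lieDeriv X g x := by
  have h' : f =ᶠ[nhds x] g := Filter.eventuallyEq_of_mem (hU.mem_nhds hx) h
  simp only [lieDeriv, mvfderiv, h'.mfderiv_eq]
  rfl

theorem lieDeriv_add (hf : MDifferentiableAt 𝓘(ℝ, E) 𝓘(ℝ, ℝ) f x)
    (hg : MDifferentiableAt 𝓘(ℝ, E) 𝓘(ℝ, ℝ) g x) :
    lieDeriv X (f + g) x = lieDeriv X f x + lieDeriv X g x := by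
  rw [lieDeriv, mvfderiv_add hf hg]
  rfl

theorem lieDeriv_mul (hf : MDifferentiableAt 𝓘(ℝ, E) 𝓘(ℝ, ℝ) f x)
    (hg : MDifferentiableAt 𝓘(ℝ, E) 𝓘(ℝ, ℝ) g x) :
    lieDeriv X (f * g) x = f x * lieDeriv X g x + g x * lieDeriv X f x := by
  rw [lieDeriv, mvfderiv_mul hf hg]
  rfl

theorem lieDeriv_const (r : ℝ) : lieDeriv X (fun _ => r) x = 0 := by
  rw [lieDeriv, mvfderiv_const]
  rfl

theorem lieDeriv_vec_add : lieDeriv (X + Y) f x = lieDeriv X f x + lieDeriv Y f x :=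
  map_add _ _ _

variable [IsManifold 𝓘(ℝ, E) ∞ M]

theorem isManifold_minSmoothness (k : ℕ) : IsManifold 𝓘(ℝ, E) (minSmoothness ℝ k) M :=
  IsManifold.of_le (n := ∞) (by
    rw [minSmoothness_of_isRCLikeNormedField]
    exact WithTop.coe_le_coe.2 (le_top : (k : ℕ∞) ≤ ⊤))

namespace SmoothOn

theorem contMDiffAt (hX : SmoothOn X U) (hU : IsOpen U) (hx : x ∈ U) :
    ContMDiffAt 𝓘(ℝ, E) (𝓘(ℝ, E).prod 𝓘(ℝ, E)) ∞
      (fun x => TotalSpace.mk' E (E := (TangentSpace 𝓘(ℝ, E) : M → Type _)) x (X x)) x :=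
  ContMDiffOn.contMDiffAt hX (hU.mem_nhds hx)

theorem mdifferentiableAt (hX : SmoothOn X U) (hU : IsOpen U) (hx : x ∈ U) :
    MDifferentiableAt 𝓘(ℝ, E) (𝓘(ℝ, E).prod 𝓘(ℝ, E))
      (fun x => TotalSpace.mk' E (E := (TangentSpace 𝓘(ℝ, E) : M → Type _)) x (X x)) x :=
  (hX.contMDiffAt hU hx).mdifferentiableAt (by simp)

theorem mono (hX : SmoothOn X U) (h : U' ⊆ U) : SmoothOn X U' := ContMDiffOn.mono hX h

theorem congr (hX : SmoothOn X U) (h : ∀ y ∈ U, Y y = X y) : SmoothOn Y U :=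
  ContMDiffOn.congr hX fun y hy => by rw [h y hy]

theorem add (hX : SmoothOn X U) (hY : SmoothOn Y U) : SmoothOn (X + Y) U :=
  ContMDiffOn.add_section hX hY

theorem sub (hX : SmoothOn X U) (hY : SmoothOn Y U) : SmoothOn (X - Y) U :=
  ContMDiffOn.sub_section hX hY

theorem neg (hX : SmoothOn X U) : SmoothOn (-X) U :=
  ContMDiffOn.neg_section hX

theorem smul (hf : ContMDiffOn 𝓘(ℝ, E) 𝓘(ℝ, ℝ) ∞ f U) (hX : SmoothOn X U) : SmoothOn (f • X) U :=
  ContMDiffOn.smul_section hf hX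

theorem sum {κ : Type*} {s : Finset κ} {X : κ → VecField E M}
    (hX : ∀ k ∈ s, SmoothOn (X k) U) : SmoothOn (fun x => ∑ k ∈ s, X k x) U :=
  ContMDiffOn.sum_section hX

/-- Smoothness is a local property. -/
theorem of_locally (h : ∀ x ∈ U, ∃ U', IsOpen U' ∧ x ∈ U' ∧ SmoothOn X (U ∩ U')) : SmoothOn X U :=
  contMDiffOn_of_locally_contMDiffOn h

theorem lieBracket [CompleteSpace E] (hX : SmoothOn X U) (hY : SmoothOn Y U) (hU : IsOpen U) :
    SmoothOn (bracket X Y) U := fun x hx => by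
  have : IsManifold 𝓘(ℝ, E) (((⊤ : ℕ∞) : WithTop ℕ∞) + 1) M := inferInstanceAs (IsManifold _ ∞ M)
  have := isManifold_minSmoothness (E := E) (M := M) 2
  exact (ContMDiffAt.mlieBracket_vectorField (m := ⊤) (n := ⊤) (hX.contMDiffAt hU hx)
    (hY.contMDiffAt hU hx) (by simp)).contMDiffWithinAt

end SmoothOn

section extendVec

theorem extendVec_self (v : TangentSpace 𝓘(ℝ, E) x) : extendVec (M := M) v x = v :=
  FiberBundle.extend_apply_self E v

/-- The extension is constant in the trivialization at `x`. -/
theorem extendVec_smoothOn (v : TangentSpace 𝓘(ℝ, E) x) :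
    SmoothOn (extendVec v)
      (trivializationAt E (TangentSpace 𝓘(ℝ, E) : M → Type _) x).baseSet := by
  intro y hy
  rw [Bundle.Trivialization.contMDiffWithinAt_section _ hy]
  have : ContMDiffOn 𝓘(ℝ, E) 𝓘(ℝ, E) ∞ (fun _ : M =>
      (trivializationAt E (TangentSpace 𝓘(ℝ, E) : M → Type _) x ⟨x, v⟩).2)
      (trivializationAt E (TangentSpace 𝓘(ℝ, E) : M → Type _) x).baseSet := contMDiffOn_const
  exact this.congr (fun y hy => by
    rw [extendVec, FiberBundle.extend, Bundle.Trivialization.apply_mk_symm _ hy]) y hy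

end extendVec

theorem contMDiffOn_lieDeriv (hX : SmoothOn X U) (hf : ContMDiffOn 𝓘(ℝ, E) 𝓘(ℝ, ℝ) ∞ f U)
    (hU : IsOpen U) : ContMDiffOn 𝓘(ℝ, E) 𝓘(ℝ, ℝ) ∞ (lieDeriv X f) U := by
  have h := hf.contMDiffOn_tangentMapWithin (m := ∞) (by simp) hU.uniqueMDiffOn
  have h₁ := h.comp hX fun y hy => hy
  have h₂ := (contMDiff_snd_tangentBundle_modelSpace ℝ 𝓘(ℝ, ℝ) (n := ∞)).comp_contMDiffOn h₁
  refine h₂.congr fun y hy => ?_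
  change mfderiv 𝓘(ℝ, E) 𝓘(ℝ, ℝ) f y (X y) = mfderivWithin 𝓘(ℝ, E) 𝓘(ℝ, ℝ) f U y (X y)
  rw [mfderivWithin_of_isOpen hU hy]

variable [RiemannianBundle (fun x : M => TangentSpace 𝓘(ℝ, E) x)]
  [IsContMDiffRiemannianBundle 𝓘(ℝ, E) ∞ E (fun x : M => TangentSpace 𝓘(ℝ, E) x)]

theorem contMDiffOn_metric (hX : SmoothOn X U) (hY : SmoothOn Y U) :
    ContMDiffOn 𝓘(ℝ, E) 𝓘(ℝ, ℝ) ∞ (metric X Y) U :=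
  ContMDiffOn.inner_bundle hX hY

theorem mdifferentiableAt_metric
    (hX : MDifferentiableAt 𝓘(ℝ, E) (𝓘(ℝ, E).prod 𝓘(ℝ, E))
      (fun x => TotalSpace.mk' E (E := (TangentSpace 𝓘(ℝ, E) : M → Type _)) x (X x)) x)
    (hY : MDifferentiableAt 𝓘(ℝ, E) (𝓘(ℝ, E).prod 𝓘(ℝ, E))
      (fun x => TotalSpace.mk' E (E := (TangentSpace 𝓘(ℝ, E) : M → Type _)) x (Y x)) x) :
    MDifferentiableAt 𝓘(ℝ, E) 𝓘(ℝ, ℝ) (metric X Y) x := by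
  have : IsContMDiffRiemannianBundle 𝓘(ℝ, E) 1 E (fun x : M => TangentSpace 𝓘(ℝ, E) x) :=
    IsContMDiffRiemannianBundle.of_le (n := ∞) (by simp)
  exact MDifferentiableAt.inner_bundle hX hY

end SmoothFields

/-! ### Lie brackets and the commutator of derivations -/

section Commutator

variable {E : Type*} [NormedAddCommGroup E] [NormedSpace ℝ E]
  {M : Type*} [TopologicalSpace M] [ChartedSpace E M]
  {U : Set M} {X Y Z : VecField E M} {f : M → ℝ} {x : M}

theorem bracket_swap (X Y : VecField E M) : bracket X Y = -bracket Y X :=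
  VectorField.mlieBracket_swap

theorem bracket_congr {X' Y' : VecField E M} (hU : IsOpen U) (hx : x ∈ U)
    (hX : ∀ y ∈ U, X y = X' y) (hY : ∀ y ∈ U, Y y = Y' y) : bracket X Y x = bracket X' Y' x :=
  Filter.EventuallyEq.mlieBracket_vectorField_eq
    (Filter.eventuallyEq_of_mem (hU.mem_nhds hx) hX)
    (Filter.eventuallyEq_of_mem (hU.mem_nhds hx) hY)

variable [FiniteDimensional ℝ E] [IsManifold 𝓘(ℝ, E) ∞ M]

theorem bracket_add_right (hU : IsOpen U) (hx : x ∈ U) (hY : SmoothOn Y U) (hZ : SmoothOn Z U) :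
    bracket X (Y + Z) x = bracket X Y x + bracket X Z x := by
  have := isManifold_minSmoothness (E := E) (M := M) 2
  have : IsManifold 𝓘(ℝ, E) 2 M := by simpa using this
  exact VectorField.mlieBracket_add_right (hY.mdifferentiableAt hU hx) (hZ.mdifferentiableAt hU hx)

theorem bracket_add_left (hU : IsOpen U) (hx : x ∈ U) (hY : SmoothOn Y U) (hZ : SmoothOn Z U) :
    bracket (Y + Z) X x = bracket Y X x + bracket Z X x := by
  rw [bracket_swap, Pi.neg_apply, bracket_add_right hU hx hY hZ, bracket_swap Y, bracket_swap Z,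
    Pi.neg_apply, Pi.neg_apply, neg_add]

theorem bracket_smul_right (hU : IsOpen U) (hx : x ∈ U)
    (hf : ContMDiffOn 𝓘(ℝ, E) 𝓘(ℝ, ℝ) ∞ f U) (hY : SmoothOn Y U) :
    bracket X (f • Y) x = lieDeriv X f x • Y x + f x • bracket X Y x := by
  have := isManifold_minSmoothness (E := E) (M := M) 2
  have : IsManifold 𝓘(ℝ, E) 2 M := by simpa using this
  exact VectorField.mlieBracket_smul_right (mdifferentiableAt_of_contMDiffOn hf hU hx)
    (hY.mdifferentiableAt hU hx)

theorem jacobi (hU : IsOpen U) (hx : x ∈ U) (hX : SmoothOn X U) (hY : SmoothOn Y U)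
    (hZ : SmoothOn Z U) :
    bracket X (bracket Y Z) x = bracket (bracket X Y) Z x + bracket Y (bracket X Z) x := by
  have := isManifold_minSmoothness (E := E) (M := M) 3
  have h : minSmoothness ℝ 2 ≤ ∞ := by
    rw [minSmoothness_of_isRCLikeNormedField]
    exact WithTop.coe_le_coe.2 (le_top : ((2 : ℕ) : ℕ∞) ≤ ⊤)
  exact VectorField.leibniz_identity_mlieBracket_apply ((hX.contMDiffAt hU hx).of_le h)
    ((hY.contMDiffAt hU hx).of_le h) ((hZ.contMDiffAt hU hx).of_le h)

/-- `[X, Y] f = X (Y f) - Y (X f)`. -/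
theorem lieDeriv_bracket (hU : IsOpen U) (hx : x ∈ U) (hX : SmoothOn X U) (hY : SmoothOn Y U)
    (hf : ContMDiffOn 𝓘(ℝ, E) 𝓘(ℝ, ℝ) ∞ f U) :
    lieDeriv (bracket X Y) f x = lieDeriv X (lieDeriv Y f) x - lieDeriv Y (lieDeriv X f) x := by
  rcases subsingleton_or_nontrivial (TangentSpace 𝓘(ℝ, E) x) with hE | hE
  · have h (Z : VecField E M) (g : M → ℝ) : lieDeriv Z g x = 0 := by
      rw [lieDeriv, Subsingleton.elim (Z x) 0, map_zero]
    rw [h, h, h, sub_zero]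
  obtain ⟨w, hw⟩ := exists_ne (0 : TangentSpace 𝓘(ℝ, E) x)
  set B := (trivializationAt E (TangentSpace 𝓘(ℝ, E) : M → Type _) x).baseSet
  have hN : IsOpen (U ∩ B) := hU.inter (Bundle.Trivialization.open_baseSet _)
  have hxN : x ∈ U ∩ B := ⟨hx, FiberBundle.mem_baseSet_trivializationAt' x⟩
  have hX := hX.mono (Set.inter_subset_left (t := B))
  have hY := hY.mono (Set.inter_subset_left (t := B))
  have hf := hf.mono (Set.inter_subset_left (t := B))
  have hW : SmoothOn (extendVec w) (U ∩ B) := (extendVec_smoothOn w).mono Set.inter_subset_right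
  set W := extendVec w with hWdef
  have hXf := contMDiffOn_lieDeriv hX hf hN
  have hYf := contMDiffOn_lieDeriv hY hf hN
  have hXW := hX.lieBracket hW hN
  have hYW := hY.lieBracket hW hN
  have key {A C : VecField E M}
      (hBf : ContMDiffOn 𝓘(ℝ, E) 𝓘(ℝ, ℝ) ∞ (lieDeriv C f) (U ∩ B))
      (hBW : SmoothOn (bracket C W) (U ∩ B)) :
      bracket A (bracket C (f • W)) x = lieDeriv A (lieDeriv C f) x • W x +
        lieDeriv C f x • bracket A W x + (lieDeriv A f x • bracket C W x +
          f x • bracket A (bracket C W) x) := by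
    rw [bracket_congr (X' := A) (Y' := lieDeriv C f • W + f • bracket C W) hN hxN
      (fun y _ => rfl) (fun y hy => bracket_smul_right hN hy hf hW),
      bracket_add_right hN hxN (SmoothOn.smul hBf hW) (SmoothOn.smul hf hBW),
      bracket_smul_right hN hxN hBf hW, bracket_smul_right hN hxN hf hBW]
  -- The Jacobi identity for X, Y and f W, expanded by the Leibniz rule, minus f times the one for
  -- X, Y, W, leaves the claim multiplied by W x, which is nonzero.
  have hJ := jacobi hN hxN hX hY (SmoothOn.smul hf hW)
  rw [key hYf hYW, key hXf hXW, bracket_smul_right hN hxN hf hW,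
    jacobi hN hxN hX hY hW] at hJ
  have hWx : W x ≠ 0 := by rwa [hWdef, extendVec_self]
  refine smul_left_injective ℝ hWx ?_
  simp only
  rw [← sub_eq_zero] at hJ ⊢
  rw [← neg_eq_zero, ← hJ]
  module

end Commutator

/-! ### Smooth orthogonal frames of a distribution -/

section Projection

variable {E : Type*} [NormedAddCommGroup E] [NormedSpace ℝ E] [FiniteDimensional ℝ E]
  {M : Type*} [TopologicalSpace M] [ChartedSpace E M] [IsManifold 𝓘(ℝ, E) ∞ M]
  [RiemannianBundle (fun x : M => TangentSpace 𝓘(ℝ, E) x)]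
  [IsContMDiffRiemannianBundle 𝓘(ℝ, E) ∞ E (fun x : M => TangentSpace 𝓘(ℝ, E) x)]
  {U : Set M} {X Y Z : VecField E M} {x : M}

theorem starProjection_span_eq_sum {T κ : Type*} [NormedAddCommGroup T] [InnerProductSpace ℝ T]
    [FiniteDimensional ℝ T] [Fintype κ] {g : κ → T} (hg : ∀ k, g k ≠ 0)
    (hgg : Pairwise fun k l => inner ℝ (g k) (g l) = 0) (v : T) :
    (Submodule.span ℝ (Set.range g)).starProjection v =
      ∑ k, (inner ℝ (g k) v / inner ℝ (g k) (g k)) • g k := by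
  refine (Submodule.eq_starProjection_of_mem_of_inner_eq_zero ?_ ?_)
  · exact Submodule.sum_mem _ fun k _ => Submodule.smul_mem _ _ (Submodule.subset_span ⟨k, rfl⟩)
  · intro w hw
    induction hw using Submodule.span_induction with
    | mem w hw =>
      obtain ⟨l, rfl⟩ := hw
      rw [inner_sub_left, sum_inner, Finset.sum_eq_single l]
      · rw [real_inner_smul_left, div_mul_cancel₀ _ (inner_self_ne_zero.2 (hg l)),
          real_inner_comm, sub_self]
      · intro k _ hk
        rw [real_inner_smul_left, hgg hk, mul_zero]
      · simp
    | zero => simp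
    | add a b _ _ ha hb => rw [inner_add_right, ha, hb, add_zero]
    | smul r a _ ha => rw [real_inner_smul_right, ha, mul_zero]

/-- Gram–Schmidt without normalisation suffices: it only divides by the nonvanishing smooth
functions ⟨G_k, G_k⟩, so no square root needs to be smooth. -/
theorem IsSmoothDistribution.exists_orthogonal_frame {D : Distribution E M} {m : ℕ}
    (hD : IsSmoothDistribution D m) (x : M) :
    ∃ U : Set M, IsOpen U ∧ x ∈ U ∧ ∃ G : Fin m → VecField E M, (∀ l, SmoothOn (G l) U) ∧
      ∀ y ∈ U, (∀ l, G l y ≠ 0) ∧ ∀ v, (D y).starProjection v =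
        ∑ l, (inner ℝ (G l y) v / inner ℝ (G l y) (G l y)) • G l y := by
  obtain ⟨U, hU, hx, Z, hZ, hspan⟩ := hD x
  let G : Fin m → VecField E M := fun l y => InnerProductSpace.gramSchmidt ℝ (fun k => Z k y) l
  have hG0 : ∀ y ∈ U, ∀ l, G l y ≠ 0 := fun y hy l =>
    InnerProductSpace.gramSchmidt_ne_zero l (hspan y hy).1
  refine ⟨U, hU, hx, G, fun l => ?_, fun y hy => ⟨hG0 y hy, fun v => ?_⟩⟩
  · induction l using WellFoundedLT.induction with
    | ind l ih =>
      have h : SmoothOn (Z l - fun y => ∑ k ∈ Finset.Iio l,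
          ((fun y => metric (G k) (Z l) y / metric (G k) (G k) y) • G k) y) U := by
        refine (hZ l).sub (SmoothOn.sum fun k hk => SmoothOn.smul ?_ (ih k (Finset.mem_Iio.1 hk)))
        have hk := ih k (Finset.mem_Iio.1 hk)
        refine (contMDiffOn_metric hk (hZ l)).div₀ (contMDiffOn_metric hk hk) fun y hy => ?_
        exact inner_self_ne_zero.2 (hG0 y hy k)
      refine h.congr fun y hy => ?_
      simp only [G]
      rw [InnerProductSpace.gramSchmidt_def]
      simp only [Submodule.starProjection_singleton]
      rw [Pi.sub_apply]
      congr 1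
      refine Finset.sum_congr rfl fun k _ => ?_
      rw [Pi.smul_apply']
      simp only [metric, real_inner_self_eq_norm_sq, RCLike.ofReal_real_eq_id, id]
  · have := starProjection_span_eq_sum (hG0 y hy)
      (InnerProductSpace.gramSchmidt_pairwise_orthogonal ℝ fun k => Z k y) v
    rw [← this, ← (hspan y hy).2]
    congr 2
    exact (InnerProductSpace.span_gramSchmidt ℝ fun k => Z k y).symm

end Projection

/-! ### Formal properties of the Koszul expression -/

section Koszul

variable {E : Type*} [NormedAddCommGroup E] [NormedSpace ℝ E]
  {M : Type*} [TopologicalSpace M] [ChartedSpace E M]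
  [RiemannianBundle (fun x : M => TangentSpace 𝓘(ℝ, E) x)]

theorem metric_comm (X Y : VecField E M) : metric X Y = metric Y X :=
  funext fun _ => real_inner_comm _ _

theorem koszul_eq (X Y W : VecField E M) (x : M) : koszul X Y W x = (1 / 2 : ℝ) *
    (lieDeriv X (metric Y W) x + lieDeriv Y (metric X W) x - lieDeriv W (metric X Y) x
      + metric (bracket X Y) W x - metric (bracket X W) Y x - metric (bracket Y W) X x) := rfl

theorem metric_apply (X Y : VecField E M) (x : M) : metric X Y x = inner ℝ (X x) (Y x) := rfl

/-- The Levi-Civita connection is metric. -/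
theorem koszul_add_koszul (X Y W : VecField E M) (x : M) :
    koszul X Y W x + koszul X W Y x = lieDeriv X (metric Y W) x := by
  have h : metric (bracket W Y) X x = -metric (bracket Y W) X x := by
    rw [bracket_swap, metric_apply, Pi.neg_apply, inner_neg_left]
    rfl
  rw [koszul_eq, koszul_eq, h, metric_comm W Y]
  ring

/-- The Levi-Civita connection is torsion-free. -/
theorem koszul_sub_koszul (X Y W : VecField E M) (x : M) :
    koszul X Y W x - koszul Y X W x = metric (bracket X Y) W x := by
  have h : metric (bracket Y X) W x = -metric (bracket X Y) W x := by
    rw [bracket_swap, metric_apply, Pi.neg_apply, inner_neg_left]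
    rfl
  rw [koszul_eq, koszul_eq, h, metric_comm Y X]
  ring

end Koszul

/-! ### Smoothness and tensoriality for the Levi-Civita connection -/

section LeviCivita

variable {E : Type*} [NormedAddCommGroup E] [NormedSpace ℝ E] [FiniteDimensional ℝ E]
  {M : Type*} [TopologicalSpace M] [ChartedSpace E M] [IsManifold 𝓘(ℝ, E) ∞ M]

theorem isSmoothDistribution_top :
    IsSmoothDistribution (fun _ => ⊤ : Distribution E M) (Module.finrank ℝ E) := by
  intro x
  set e := trivializationAt E (TangentSpace 𝓘(ℝ, E) : M → Type _) x
  have h := e.isLocalFrameOn_localFrame_baseSet 𝓘(ℝ, E) ∞ (Module.finBasis ℝ E)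
  refine ⟨e.baseSet, e.open_baseSet, FiberBundle.mem_baseSet_trivializationAt' x,
    e.localFrame (Module.finBasis ℝ E), fun l => h.contMDiffOn l, fun y hy =>
    ⟨h.linearIndependent hy, top_le_iff.1 (h.generating hy)⟩⟩

variable [RiemannianBundle (fun x : M => TangentSpace 𝓘(ℝ, E) x)]
  [IsContMDiffRiemannianBundle 𝓘(ℝ, E) ∞ E (fun x : M => TangentSpace 𝓘(ℝ, E) x)]
  {U : Set M} {X Y Z W : VecField E M} {x : M}

theorem SmoothOn.proj {D : Distribution E M} {m : ℕ} (hD : IsSmoothDistribution D m)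
    (hX : SmoothOn X U) : SmoothOn (proj D X) U := by
  refine SmoothOn.of_locally fun x hx => ?_
  obtain ⟨U', hU', hxU', G, hG, hproj⟩ := hD.exists_orthogonal_frame x
  refine ⟨U', hU', hxU', ?_⟩
  have hX' : SmoothOn X (U ∩ U') := hX.mono Set.inter_subset_left
  have hG' (l) : SmoothOn (G l) (U ∩ U') := (hG l).mono Set.inter_subset_right
  have h : SmoothOn (fun y => ∑ l,
      ((fun y => metric (G l) X y / metric (G l) (G l) y) • G l) y) (U ∩ U') := by
    refine SmoothOn.sum fun l _ => SmoothOn.smul ?_ (hG' l)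
    refine (contMDiffOn_metric (hG' l) hX').div₀ (contMDiffOn_metric (hG' l) (hG' l)) fun y hy => ?_
    exact inner_self_ne_zero.2 ((hproj y hy.2).1 l)
  exact h.congr fun y hy => (hproj y hy.2).2 (X y)

/-- A vector field is smooth if its inner products with smooth vector fields are. -/
theorem SmoothOn.of_metric (hU : IsOpen U) (h : ∀ U' ⊆ U, IsOpen U' → ∀ W, SmoothOn W U' →
    ContMDiffOn 𝓘(ℝ, E) 𝓘(ℝ, ℝ) ∞ (metric X W) U') : SmoothOn X U := by
  refine SmoothOn.of_locally fun x hx => ?_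
  obtain ⟨U', hU', hxU', G, hG, hproj⟩ :=
    (isSmoothDistribution_top (E := E) (M := M)).exists_orthogonal_frame x
  refine ⟨U', hU', hxU', ?_⟩
  have hG' (l) : SmoothOn (G l) (U ∩ U') := (hG l).mono Set.inter_subset_right
  have h : SmoothOn (fun y => ∑ l,
      ((fun y => metric X (G l) y / metric (G l) (G l) y) • G l) y) (U ∩ U') := by
    refine SmoothOn.sum fun l _ => SmoothOn.smul ?_ (hG' l)
    refine (h _ Set.inter_subset_left (hU.inter hU') _ (hG' l)).div₀
      (contMDiffOn_metric (hG' l) (hG' l)) fun y hy => ?_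
    exact inner_self_ne_zero.2 ((hproj y hy.2).1 l)
  refine h.congr fun y hy => ?_
  have := (hproj y hy.2).2 (X y)
  rw [Submodule.starProjection_top] at this
  rw [← ContinuousLinearMap.id_apply (R₁ := ℝ) (X y), this]
  exact Finset.sum_congr rfl fun l _ => by rw [metric_comm X]; rfl

/-- Replacing W by f W, the derivatives of f from X⟨Y, W⟩ and Y⟨X, W⟩ cancel those from the brackets
[X, W] and [Y, W]. Hence the extensions of basis vectors in the definition of `leviCivita` can be
exchanged for any smooth W. -/
theorem koszul_tensorialAt
    (hX : MDifferentiableAt 𝓘(ℝ, E) (𝓘(ℝ, E).prod 𝓘(ℝ, E))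
      (fun x => TotalSpace.mk' E (E := (TangentSpace 𝓘(ℝ, E) : M → Type _)) x (X x)) x)
    (hY : MDifferentiableAt 𝓘(ℝ, E) (𝓘(ℝ, E).prod 𝓘(ℝ, E))
      (fun x => TotalSpace.mk' E (E := (TangentSpace 𝓘(ℝ, E) : M → Type _)) x (Y x)) x) :
    TensorialAt 𝓘(ℝ, E) E (V := (TangentSpace 𝓘(ℝ, E) : M → Type _))
      (fun W => koszul X Y W x) x := by
  have := isManifold_minSmoothness (E := E) (M := M) 2
  have : IsManifold 𝓘(ℝ, E) 2 M := by simpa using this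
  refine ⟨fun {f W} hf hW => ?_, fun {W W'} hW hW' => ?_⟩
  · have h₁ (Z : VecField E M) : metric Z (f • W) = f * metric Z W :=
      funext fun y => real_inner_smul_right _ _ _
    have h₂ (Z : VecField E M) :
        bracket Z (f • W) x = lieDeriv Z f x • W x + f x • bracket Z W x :=
      VectorField.mlieBracket_smul_right hf hW
    have h₃ : lieDeriv (f • W) (metric X Y) x = f x * lieDeriv W (metric X Y) x :=
      map_smul (mvfderiv 𝓘(ℝ, E) (metric X Y) x) (f x) (W x)
    have h₄ (Z Z' : VecField E M) : metric (bracket Z (f • W)) Z' x =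
        lieDeriv Z f x * metric W Z' x + f x * metric (bracket Z W) Z' x := by
      rw [metric_apply, h₂, inner_add_left, real_inner_smul_left, real_inner_smul_left]
      rfl
    simp only [koszul_eq, h₁, h₃, h₄, lieDeriv_mul hf (mdifferentiableAt_metric hX hW),
      lieDeriv_mul hf (mdifferentiableAt_metric hY hW), Pi.mul_apply, smul_eq_mul]
    rw [metric_comm W Y, metric_comm W X]
    ring
  · have h₁ (Z : VecField E M) : metric Z (W + W') = metric Z W + metric Z W' :=
      funext fun y => inner_add_right _ _ _
    have h₃ : lieDeriv (W + W') (metric X Y) x =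
        lieDeriv W (metric X Y) x + lieDeriv W' (metric X Y) x :=
      map_add (mvfderiv 𝓘(ℝ, E) (metric X Y) x) (W x) (W' x)
    have h₄ (Z Z' : VecField E M) : metric (bracket Z (W + W')) Z' x =
        metric (bracket Z W) Z' x + metric (bracket Z W') Z' x := by
      have : bracket Z (W + W') x = bracket Z W x + bracket Z W' x :=
        VectorField.mlieBracket_add_right hW hW'
      rw [metric_apply, this, inner_add_left]
      rfl
    simp only [koszul_eq, h₁, h₃, h₄,
      lieDeriv_add (mdifferentiableAt_metric hX hW) (mdifferentiableAt_metric hX hW'),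
      lieDeriv_add (mdifferentiableAt_metric hY hW) (mdifferentiableAt_metric hY hW'),
      Pi.add_apply]
    ring

/-- The Koszul formula for the Levi-Civita connection. -/
theorem metric_leviCivita (hU : IsOpen U) (hx : x ∈ U) (hX : SmoothOn X U) (hY : SmoothOn Y U)
    (hW : SmoothOn W U) : metric (leviCivita X Y) W x = koszul X Y W x := by
  have := isManifold_minSmoothness (E := E) (M := M) 2
  have : IsManifold 𝓘(ℝ, E) (1 + 1) M := by
    rw [one_add_one_eq_two]
    simpa using this
  have hT := koszul_tensorialAt (hX.mdifferentiableAt hU hx) (hY.mdifferentiableAt hU hx)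
  have hb (v : TangentSpace 𝓘(ℝ, E) x) :
      koszul X Y (extendVec v) x = TensorialAt.mkHom _ x hT v := rfl
  rw [← hT.mkHom_apply (hW.mdifferentiableAt hU hx), metric_apply, leviCivita, sum_inner]
  conv_rhs => rw [← (stdOrthonormalBasis ℝ (TangentSpace 𝓘(ℝ, E) x)).sum_repr (W x), map_sum]
  refine Finset.sum_congr rfl fun a _ => ?_
  rw [real_inner_smul_left, hb, map_smul, OrthonormalBasis.repr_apply_apply, smul_eq_mul, mul_comm]

theorem contMDiffOn_koszul (hU : IsOpen U) (hX : SmoothOn X U) (hY : SmoothOn Y U)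
    (hW : SmoothOn W U) : ContMDiffOn 𝓘(ℝ, E) 𝓘(ℝ, ℝ) ∞ (koszul X Y W) U := by
  have h₁ := contMDiffOn_lieDeriv hX (contMDiffOn_metric hY hW) hU
  have h₂ := contMDiffOn_lieDeriv hY (contMDiffOn_metric hX hW) hU
  have h₃ := contMDiffOn_lieDeriv hW (contMDiffOn_metric hX hY) hU
  have h₄ := contMDiffOn_metric (hX.lieBracket hY hU) hW
  have h₅ := contMDiffOn_metric (hX.lieBracket hW hU) hY
  have h₆ := contMDiffOn_metric (hY.lieBracket hW hU) hX
  exact contMDiffOn_const.mul (((((h₁.add h₂).sub h₃).add h₄).sub h₅).sub h₆)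

theorem SmoothOn.leviCivita (hU : IsOpen U) (hX : SmoothOn X U) (hY : SmoothOn Y U) :
    SmoothOn (leviCivita X Y) U := by
  refine SmoothOn.of_metric hU fun U' hU'U hU' W hW => ?_
  exact (contMDiffOn_koszul hU' (hX.mono hU'U) (hY.mono hU'U) hW).congr fun y hy =>
    metric_leviCivita hU' hy (hX.mono hU'U) (hY.mono hU'U) hW

end LeviCivita

/-! ### The two halves of the Bott connection and their curvature -/

section PartialBott

variable {E : Type*} [NormedAddCommGroup E] [NormedSpace ℝ E]
  {M : Type*} [TopologicalSpace M] [ChartedSpace E M]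
  [RiemannianBundle (fun x : M => TangentSpace 𝓘(ℝ, E) x)] [FiniteDimensional ℝ E]
  {P Q : Distribution E M} {X Y Z : VecField E M} {x : M}

theorem metric_proj_left (P : Distribution E M) (X Y : VecField E M) :
    metric (proj P X) Y = metric X (proj P Y) :=
  funext fun x => Submodule.inner_starProjection_left_eq_right (P x) (X x) (Y x)

theorem proj_proj (P : Distribution E M) (X : VecField E M) : proj P (proj P X) = proj P X :=
  funext fun _ => Submodule.starProjection_eq_self_iff.2 (Submodule.starProjection_apply_mem _ _)

theorem proj_add (P : Distribution E M) (X Y : VecField E M) :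
    proj P (X + Y) = proj P X + proj P Y :=
  funext fun _ => map_add _ _ _

theorem proj_mem (P : Distribution E M) (X : VecField E M) (x : M) : proj P X x ∈ P x :=
  Submodule.starProjection_apply_mem _ _

theorem proj_proj_of_orthogonal (h : ∀ x, Q x = (P x)ᗮ) (X : VecField E M) :
    proj P (proj Q X) = 0 :=
  funext fun x => by
    have : proj Q X x ∈ (P x)ᗮ := h x ▸ proj_mem Q X x
    exact (Submodule.starProjection_apply_eq_zero_iff (P x)).2 this

theorem proj_add_proj_of_orthogonal (h : ∀ x, Q x = (P x)ᗮ) (X : VecField E M) :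
    proj P X + proj Q X = X :=
  funext fun x => by
    have : proj Q X x = (P x)ᗮ.starProjection (X x) := by simp only [proj, h x]
    rw [Pi.add_apply, this, Submodule.starProjection_orthogonal']
    simp [proj]

variable [IsManifold 𝓘(ℝ, E) ∞ M]

/-- The restriction to the second argument in `P` of the Bott connection of a splitting of the
tangent bundle into `P` and `Q`. -/
def partialBott (P Q : Distribution E M) (X Y : VecField E M) : VecField E M :=
  proj P (leviCivita (proj P X) (proj P Y)) + proj P (bracket (proj Q X) (proj P Y))

theorem bott_eq_add (V : Distribution E M) (X Y : VecField E M) :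
    bott V X Y = partialBott (horizontal V) V X Y + partialBott V (horizontal V) X Y := by
  simp only [bott, partialBott]
  abel

/-- The curvature of `partialBott P Q`. -/
def partialCurvature (P Q : Distribution E M) (X Y A : VecField E M) : VecField E M :=
  partialBott P Q X (partialBott P Q Y A) - partialBott P Q Y (partialBott P Q X A) -
    partialBott P Q (bracket X Y) A

theorem proj_partialBott (P Q : Distribution E M) (X Y : VecField E M) :
    proj P (partialBott P Q X Y) = partialBott P Q X Y := by
  rw [partialBott, ← proj_add, proj_proj]

theorem partialBott_mem (P Q : Distribution E M) (X Y : VecField E M) (x : M) :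
    partialBott P Q X Y x ∈ P x := by
  rw [← proj_partialBott]
  exact proj_mem _ _ _

theorem partialBott_congr_proj {A B : VecField E M} (h : proj P A = proj P B) :
    partialBott P Q X A = partialBott P Q X B := by
  rw [partialBott, partialBott, h]

theorem partialCurvature_mem (P Q : Distribution E M) (X Y A : VecField E M) (x : M) :
    partialCurvature P Q X Y A x ∈ P x :=
  Submodule.sub_mem _ (Submodule.sub_mem _ (partialBott_mem _ _ _ _ _) (partialBott_mem _ _ _ _ _))
    (partialBott_mem _ _ _ _ _)

/-- An orthogonal splitting of the tangent bundle into smooth distributions `P` and `Q`, such that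
the metric of `P` is invariant under the flows of sections of `Q`. -/
structure IsInvariantSplitting (P Q : Distribution E M) : Prop where
  eq_orthogonal_left : ∀ x, Q x = (P x)ᗮ
  eq_orthogonal_right : ∀ x, P x = (Q x)ᗮ
  smoothOn_proj_left : ∀ {U : Set M} {X : VecField E M}, SmoothOn X U → SmoothOn (proj P X) U
  smoothOn_proj_right : ∀ {U : Set M} {X : VecField E M}, SmoothOn X U → SmoothOn (proj Q X) U
  invariant : ∀ {U : Set M} {X Y Z : VecField E M}, IsOpen U → SmoothOn X U → SmoothOn Y U →
    SmoothOn Z U → ∀ x ∈ U, lieDeriv (proj Q Z) (metric (proj P X) (proj P Y)) x =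
      metric (bracket (proj Q Z) (proj P X)) (proj P Y) x +
        metric (bracket (proj Q Z) (proj P Y)) (proj P X) x

/-- Each half takes values in its own bundle and sees only that component of its second argument, so
mixed compositions drop out. -/
theorem bottCurvature_eq_add {V : Distribution E M}
    (h : IsInvariantSplitting (horizontal V) V) (x : M) (u v w : TangentSpace 𝓘(ℝ, E) x) :
    bottCurvature V x u v w =
      partialCurvature (horizontal V) V (extendVec u) (extendVec v) (extendVec w) x +
        partialCurvature V (horizontal V) (extendVec u) (extendVec v) (extendVec w) x := by
  have h₁ (X Y A : VecField E M) : bott V X (bott V Y A) =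
      partialBott (horizontal V) V X (partialBott (horizontal V) V Y A) +
        partialBott V (horizontal V) X (partialBott V (horizontal V) Y A) := by
    rw [bott_eq_add, bott_eq_add V Y]
    congr 1
    · apply partialBott_congr_proj
      rw [proj_add, ← proj_partialBott V, proj_proj_of_orthogonal h.eq_orthogonal_left, add_zero]
    · apply partialBott_congr_proj
      rw [proj_add, ← proj_partialBott (horizontal V),
        proj_proj_of_orthogonal h.eq_orthogonal_right, zero_add]
  rw [bottCurvature, h₁, h₁, bott_eq_add]
  simp only [partialCurvature, Pi.add_apply, Pi.sub_apply]
  abel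

variable [IsContMDiffRiemannianBundle 𝓘(ℝ, E) ∞ E (fun x : M => TangentSpace 𝓘(ℝ, E) x)]
  {U : Set M} {A B C : VecField E M}

namespace IsInvariantSplitting

variable (h : IsInvariantSplitting P Q)

include h

theorem smoothOn_partialBott (hU : IsOpen U) (hX : SmoothOn X U) (hY : SmoothOn Y U) :
    SmoothOn (partialBott P Q X Y) U :=
  (h.smoothOn_proj_left (SmoothOn.leviCivita hU (h.smoothOn_proj_left hX)
    (h.smoothOn_proj_left hY))).add (h.smoothOn_proj_left
      ((h.smoothOn_proj_right hX).lieBracket (h.smoothOn_proj_left hY) hU))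

theorem metric_partialBott (hU : IsOpen U) (hx : x ∈ U) (hX : SmoothOn X U) (hA : SmoothOn A U)
    (hB : SmoothOn B U) : metric (partialBott P Q X A) B x =
      koszul (proj P X) (proj P A) (proj P B) x +
        metric (bracket (proj Q X) (proj P A)) (proj P B) x := by
  rw [← metric_leviCivita hU hx (h.smoothOn_proj_left hX) (h.smoothOn_proj_left hA)
    (h.smoothOn_proj_left hB), ← metric_proj_left, ← metric_proj_left]
  exact inner_add_left _ _ _

/-- `partialBott P Q` is metric. -/
theorem metric_partialBott_add (hU : IsOpen U) (hx : x ∈ U) (hX : SmoothOn X U)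
    (hA : SmoothOn A U) (hB : SmoothOn B U) :
    metric (partialBott P Q X A) B x + metric (partialBott P Q X B) A x =
      lieDeriv X (metric (proj P A) B) x := by
  have h₁ : lieDeriv X (metric (proj P A) B) x =
      lieDeriv (proj P X) (metric (proj P A) (proj P B)) x +
        lieDeriv (proj Q X) (metric (proj P A) (proj P B)) x := by
    rw [← lieDeriv_vec_add, proj_add_proj_of_orthogonal h.eq_orthogonal_left, ← metric_proj_left,
      proj_proj]
  -- Along P X this is metricity of the Levi-Civita connection, along Q X the invariance of the
  -- metric of P.
  rw [h.metric_partialBott hU hx hX hA hB, h.metric_partialBott hU hx hX hB hA, h₁,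
    h.invariant hU hA hB hX x hx, ← koszul_add_koszul]
  ring

/-- Metricity expresses ⟨D_X A, W⟩ as X⟨PA, W⟩ - ⟨D_X W, PA⟩, which is additive in the P-component
of A. -/
theorem partialBott_add (hU : IsOpen U) (hx : x ∈ U) (hX : SmoothOn X U) (hA : SmoothOn A U)
    (hB : SmoothOn B U) (hC : SmoothOn C U)
    (hABC : ∀ y ∈ U, proj P A y = proj P B y + proj P C y) :
    partialBott P Q X A x = partialBott P Q X B x + partialBott P Q X C x := by
  refine ext_inner_right ℝ fun w => ?_
  set N := (trivializationAt E (TangentSpace 𝓘(ℝ, E) : M → Type _) x).baseSet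
  have hN : IsOpen (U ∩ N) := hU.inter (Bundle.Trivialization.open_baseSet _)
  have hxN : x ∈ U ∩ N := ⟨hx, FiberBundle.mem_baseSet_trivializationAt' x⟩
  have hX := hX.mono (Set.inter_subset_left (t := N))
  have hA := hA.mono (Set.inter_subset_left (t := N))
  have hB := hB.mono (Set.inter_subset_left (t := N))
  have hC := hC.mono (Set.inter_subset_left (t := N))
  have hW : SmoothOn (extendVec w) (U ∩ N) := (extendVec_smoothOn w).mono Set.inter_subset_right
  have e (Z : VecField E M) : inner ℝ (Z x) w = metric Z (extendVec w) x := by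
    rw [metric_apply, extendVec_self]
  have hD (Z : VecField E M) : metric (partialBott P Q X (extendVec w)) Z x =
      inner ℝ (partialBott P Q X (extendVec w) x) (proj P Z x) := by
    have := congrFun (metric_proj_left P (partialBott P Q X (extendVec w)) Z) x
    rwa [proj_partialBott] at this
  have hl : lieDeriv X (metric (proj P A) (extendVec w)) x =
      lieDeriv X (metric (proj P B) (extendVec w) + metric (proj P C) (extendVec w)) x :=
    lieDeriv_congr hN hxN fun y hy => by
      rw [Pi.add_apply, metric_apply, hABC y hy.1, inner_add_left]
      rfl
  have hmB := mdifferentiableAt_of_contMDiffOn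
    (contMDiffOn_metric (h.smoothOn_proj_left hB) hW) hN hxN
  have hmC := mdifferentiableAt_of_contMDiffOn
    (contMDiffOn_metric (h.smoothOn_proj_left hC) hW) hN hxN
  rw [lieDeriv_add hmB hmC, ← h.metric_partialBott_add hN hxN hX hA hW,
    ← h.metric_partialBott_add hN hxN hX hB hW, ← h.metric_partialBott_add hN hxN hX hC hW,
    hD, hD, hD, hABC x hx, inner_add_right] at hl
  rw [inner_add_left, e, e, e]
  linarith

theorem partialBott_zero (hU : IsOpen U) (hx : x ∈ U) (hX : SmoothOn X U) :
    partialBott P Q X 0 x = 0 := by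
  have h0 : SmoothOn (0 : VecField E M) U := by
    have := hX.sub hX
    rwa [sub_self] at this
  have hp : proj P (0 : VecField E M) = 0 := funext fun _ => map_zero _
  have := h.partialBott_add hU hx hX h0 h0 h0 fun y _ => by rw [hp]; simp
  simpa using this

/-- The curvature of `partialBott P Q` is skew-symmetric. -/
theorem metric_partialCurvature (hU : IsOpen U) (hx : x ∈ U) (hX : SmoothOn X U)
    (hY : SmoothOn Y U) (hA : SmoothOn A U) (hB : SmoothOn B U) :
    metric (partialCurvature P Q X Y A) B x = -metric (partialCurvature P Q X Y B) A x := by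
  have hD {X A : VecField E M} (hX : SmoothOn X U) (hA : SmoothOn A U) :=
    h.smoothOn_partialBott hU hX hA
  have c {X A B : VecField E M} (hX : SmoothOn X U) (hA : SmoothOn A U) (hB : SmoothOn B U) :=
    h.metric_partialBott_add hU hx hX hA hB
  have key {X Y : VecField E M} (hX : SmoothOn X U) (hY : SmoothOn Y U) :
      lieDeriv X (lieDeriv Y (metric (proj P A) B)) x =
        metric (partialBott P Q X (partialBott P Q Y A)) B x +
          metric (partialBott P Q X B) (partialBott P Q Y A) x +
        (metric (partialBott P Q X (partialBott P Q Y B)) A x +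
          metric (partialBott P Q X A) (partialBott P Q Y B) x) := by
    have e : lieDeriv X (lieDeriv Y (metric (proj P A) B)) x =
        lieDeriv X (metric (partialBott P Q Y A) B + metric (partialBott P Q Y B) A) x :=
      lieDeriv_congr hU hx fun y hy => (h.metric_partialBott_add hU hy hY hA hB).symm
    rw [e, lieDeriv_add
      (mdifferentiableAt_of_contMDiffOn (contMDiffOn_metric (hD hY hA) hB) hU hx)
      (mdifferentiableAt_of_contMDiffOn (contMDiffOn_metric (hD hY hB) hA) hU hx),
      c hX (hD hY hA) hB, c hX (hD hY hB) hA, proj_partialBott, proj_partialBott]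
  have hf := contMDiffOn_metric (h.smoothOn_proj_left hA) hB
  have hXY := lieDeriv_bracket hU hx hX hY hf
  -- In X Y ⟨PA, B⟩ - Y X ⟨PA, B⟩ the products of first derivatives cancel by symmetry, leaving the
  -- second derivatives that form the curvature.
  rw [← c (hX.lieBracket hY hU) hA hB, key hX hY, key hY hX,
    metric_comm (partialBott P Q Y B) (partialBott P Q X A),
    metric_comm (partialBott P Q Y A) (partialBott P Q X B)] at hXY
  have e (A B : VecField E M) : metric (partialCurvature P Q X Y A) B x =
      metric (partialBott P Q X (partialBott P Q Y A)) B x -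
        metric (partialBott P Q Y (partialBott P Q X A)) B x -
        metric (partialBott P Q (bracket X Y) A) B x := by
    simp only [metric_apply, partialCurvature, Pi.sub_apply, inner_sub_left]
  rw [e, e]
  linarith

/-- The torsion of `partialBott P Q` vanishes modulo `Q`, for `Q` involutive. -/
theorem partialBott_sub (hQ : IsInvolutive Q) (hU : IsOpen U) (hx : x ∈ U) (hX : SmoothOn X U)
    (hY : SmoothOn Y U) :
    partialBott P Q X Y x = partialBott P Q Y X x + proj P (bracket X Y) x := by
  refine ext_inner_right ℝ fun w => ?_
  set N := (trivializationAt E (TangentSpace 𝓘(ℝ, E) : M → Type _) x).baseSet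
  have hN : IsOpen (U ∩ N) := hU.inter (Bundle.Trivialization.open_baseSet _)
  have hxN : x ∈ U ∩ N := ⟨hx, FiberBundle.mem_baseSet_trivializationAt' x⟩
  have hX := hX.mono (Set.inter_subset_left (t := N))
  have hY := hY.mono (Set.inter_subset_left (t := N))
  have hW : SmoothOn (extendVec w) (U ∩ N) := (extendVec_smoothOn w).mono Set.inter_subset_right
  have e (Z : VecField E M) : inner ℝ (Z x) w = metric Z (extendVec w) x := by
    rw [metric_apply, extendVec_self]
  have hPX := h.smoothOn_proj_left hX
  have hPY := h.smoothOn_proj_left hY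
  have hQX := h.smoothOn_proj_right hX
  have hQY := h.smoothOn_proj_right hY
  have hbr : bracket X Y x = bracket (proj P X) (proj P Y) x + bracket (proj P X) (proj Q Y) x +
      (bracket (proj Q X) (proj P Y) x + bracket (proj Q X) (proj Q Y) x) := by
    conv_lhs => rw [← proj_add_proj_of_orthogonal h.eq_orthogonal_left X,
      ← proj_add_proj_of_orthogonal h.eq_orthogonal_left Y]
    rw [bracket_add_left hN hxN hPX hQX, bracket_add_right hN hxN hPY hQY,
      bracket_add_right hN hxN hPY hQY]
  -- Involutivity enters only for the bracket of the two Q-components. The mixed brackets match by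
  -- definition, and the two P-components by torsion-freeness.
  have hQQ : metric (bracket (proj Q X) (proj Q Y)) (proj P (extendVec w)) x = 0 := by
    have h₁ := hQ _ hN _ _ ⟨hQX, fun y _ => proj_mem _ _ _⟩ ⟨hQY, fun y _ => proj_mem _ _ _⟩ x hxN
    rw [h.eq_orthogonal_left, Submodule.mem_orthogonal'] at h₁
    exact h₁ _ (proj_mem _ _ _)
  have hsw : metric (bracket (proj P X) (proj Q Y)) (proj P (extendVec w)) x =
      -metric (bracket (proj Q Y) (proj P X)) (proj P (extendVec w)) x := by
    rw [bracket_swap, metric_apply, Pi.neg_apply, inner_neg_left]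
    rfl
  have hm : metric (bracket X Y) (proj P (extendVec w)) x =
      metric (bracket (proj P X) (proj P Y)) (proj P (extendVec w)) x +
      metric (bracket (proj P X) (proj Q Y)) (proj P (extendVec w)) x +
      (metric (bracket (proj Q X) (proj P Y)) (proj P (extendVec w)) x +
      metric (bracket (proj Q X) (proj Q Y)) (proj P (extendVec w)) x) := by
    simp only [metric_apply, hbr, inner_add_left]
  rw [inner_add_left, e, e, e, h.metric_partialBott hN hxN hX hY hW,
    h.metric_partialBott hN hxN hY hX hW, metric_proj_left P (bracket X Y), hm, hQQ, hsw]
  linarith [koszul_sub_koszul (proj P X) (proj P Y) (proj P (extendVec w)) x]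

/-- The torsion identity turns linearity in the direction into additivity in the second argument. -/
theorem partialBott_neg_left (hQ : IsInvolutive Q) (hU : IsOpen U) (hx : x ∈ U)
    (hX : SmoothOn X U) (hY : SmoothOn Y U) :
    partialBott P Q (-X) Y x = -partialBott P Q X Y x := by
  have h0 : SmoothOn (0 : VecField E M) U := by
    have := hX.sub hX
    rwa [sub_self] at this
  have h₁ := h.partialBott_add hU hx hY h0 hX.neg hX fun y _ => by
    rw [← Pi.add_apply, ← proj_add, neg_add_cancel]
  have h₂ : proj P (bracket (-X) Y) x + proj P (bracket X Y) x = 0 := by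
    have : bracket (-X) Y x + bracket X Y x = 0 := by
      rw [← bracket_add_left hU hx hX.neg hX, neg_add_cancel, bracket,
        VectorField.mlieBracket_zero_left]
      rfl
    rw [proj, proj, ← map_add, this, map_zero]
  rw [h.partialBott_zero hU hx hY] at h₁
  rw [eq_neg_iff_add_eq_zero, h.partialBott_sub hQ hU hx hX.neg hY,
    h.partialBott_sub hQ hU hx hX hY, add_add_add_comm, ← h₁, h₂, add_zero]

theorem partialCurvature_swap (hQ : IsInvolutive Q) (hU : IsOpen U) (hx : x ∈ U)
    (hX : SmoothOn X U) (hY : SmoothOn Y U) (hA : SmoothOn A U) :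
    partialCurvature P Q X Y A x = -partialCurvature P Q Y X A x := by
  simp only [partialCurvature, Pi.sub_apply]
  rw [bracket_swap X Y, h.partialBott_neg_left hQ hU hx (hY.lieBracket hX hU) hA]
  abel

/-- The first Bianchi identity for `partialBott P Q`. -/
theorem partialCurvature_bianchi (hQ : IsInvolutive Q) (hU : IsOpen U) (hx : x ∈ U)
    (hX : SmoothOn X U) (hY : SmoothOn Y U) (hA : SmoothOn A U) :
    partialCurvature P Q X Y A x + partialCurvature P Q Y A X x +
      partialCurvature P Q A X Y x = 0 := by
  -- Exchanging the inner arguments, then the outer ones with the bracket, by vanishing torsion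
  -- modulo Q. In the cyclic sum the connection terms cancel, and the double brackets vanish by
  -- Jacobi.
  have key {X Y Z : VecField E M} (hX : SmoothOn X U) (hY : SmoothOn Y U) (hZ : SmoothOn Z U) :
      partialBott P Q X (partialBott P Q Y Z) x = partialBott P Q X (partialBott P Q Z Y) x +
        (partialBott P Q (bracket Y Z) X x + proj P (bracket X (bracket Y Z)) x) := by
    rw [← h.partialBott_sub hQ hU hx hX (hY.lieBracket hZ hU)]
    refine h.partialBott_add hU hx hX (h.smoothOn_partialBott hU hY hZ)
      (h.smoothOn_partialBott hU hZ hY) (hY.lieBracket hZ hU) fun y hy => ?_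
    rw [proj_partialBott, proj_partialBott]
    exact h.partialBott_sub hQ hU hy hY hZ
  have hJ : proj P (bracket X (bracket Y A)) x + proj P (bracket Y (bracket A X)) x +
      proj P (bracket A (bracket X Y)) x = 0 := by
    have h₁ : bracket X (bracket Y A) x + bracket Y (bracket A X) x +
        bracket A (bracket X Y) x = 0 := by
      have h₂ : bracket Y (bracket A X) x = -bracket Y (bracket X A) x := by
        rw [bracket_swap Y, bracket_swap A X, Pi.neg_apply, bracket_swap Y (bracket X A),
          Pi.neg_apply, eq_neg_iff_add_eq_zero, ← neg_add, neg_eq_zero,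
          ← bracket_add_left hU hx (hX.lieBracket hA hU).neg (hX.lieBracket hA hU), neg_add_cancel,
          bracket, VectorField.mlieBracket_zero_left]
        rfl
      rw [jacobi hU hx hX hY hA, h₂, bracket_swap A]
      simp
    simp only [proj, ← map_add, h₁, map_zero]
  simp only [partialCurvature, Pi.sub_apply]
  rw [key hX hY hA, key hY hA hX, key hA hX hY, ← hJ]
  abel

end IsInvariantSplitting

end PartialBott

/-! ### Curvature of totally geodesic Riemannian foliations -/

section Foliation

variable {E : Type*} [NormedAddCommGroup E] [NormedSpace ℝ E]
  {M : Type*} [TopologicalSpace M] [ChartedSpace E M]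

theorem IsSmoothDistribution.finrank_eq [IsManifold 𝓘(ℝ, E) ∞ M] {V : Distribution E M} {m : ℕ}
    (hV : IsSmoothDistribution V m) (x : M) : Module.finrank ℝ (V x) = m := by
  obtain ⟨U, -, hx, Z, -, h⟩ := hV x
  rw [← (h x hx).2, finrank_span_eq_card (h x hx).1, Fintype.card_fin]

variable [RiemannianBundle (fun x : M => TangentSpace 𝓘(ℝ, E) x)]

theorem metric_bracket_swap (X Y Z : VecField E M) :
    metric (bracket X Y) Z = -metric (bracket Y X) Z := by
  rw [bracket_swap]
  exact funext fun _ => inner_neg_left _ _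

variable [FiniteDimensional ℝ E] {V : Distribution E M} {m : ℕ}

theorem proj_horizontal (V : Distribution E M) (X : VecField E M) :
    proj (horizontal V) X = X - proj V X :=
  eq_sub_of_add_eq' (proj_add_proj_of_orthogonal (fun _ => rfl) X)

theorem horizontal_orthogonal (V : Distribution E M) (x : M) : V x = (horizontal V x)ᗮ :=
  (Submodule.orthogonal_orthogonal (V x)).symm

variable [IsManifold 𝓘(ℝ, E) ∞ M]

theorem IsSmoothDistribution.finrank_orthogonal (hV : IsSmoothDistribution V m) {n : ℕ}
    (hdim : Module.finrank ℝ E = n + m) (x : M) : Module.finrank ℝ (V x)ᗮ = n := by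
  have h := Submodule.finrank_add_finrank_orthogonal (V x)
  rw [hV.finrank_eq] at h
  have h' : Module.finrank ℝ (TangentSpace 𝓘(ℝ, E) x) = n + m := hdim
  omega

variable [IsContMDiffRiemannianBundle 𝓘(ℝ, E) ∞ E (fun x : M => TangentSpace 𝓘(ℝ, E) x)]

namespace IsTotallyGeodesicRiemannianFoliation

variable (hV : IsTotallyGeodesicRiemannianFoliation V m)

include hV

theorem smoothOn_proj_horizontal {U : Set M} {X : VecField E M} (hX : SmoothOn X U) :
    SmoothOn (proj (horizontal V) X) U := by
  rw [proj_horizontal]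
  exact hX.sub (SmoothOn.proj hV.smooth hX)

/-- The horizontal metric is invariant under the flows of vertical vector fields. -/
theorem isInvariantSplitting_horizontal : IsInvariantSplitting (horizontal V) V where
  eq_orthogonal_left := horizontal_orthogonal V
  eq_orthogonal_right _ := rfl
  smoothOn_proj_left := hV.smoothOn_proj_horizontal
  smoothOn_proj_right := SmoothOn.proj hV.smooth
  invariant {U X Y Z} hU hX hY hZ x hx := by
    have hA := hV.smoothOn_proj_horizontal hX
    have hB := hV.smoothOn_proj_horizontal hY
    have hN := SmoothOn.proj hV.smooth hZ
    have hNV : IsSection V (proj V Z) U := ⟨hN, fun y _ => proj_mem _ _ _⟩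
    have h (A : VecField E M) (hA : SmoothOn A U) (hAH : ∀ y ∈ U, A y ∈ horizontal V y) :
        lieDeriv (proj V Z) (metric A A) x = 2 * metric (bracket (proj V Z) A) A x := by
      have := hV.bundleLike U hU _ A hNV ⟨hA, hAH⟩ x hx
      rw [lieDerivMetric, metric_comm A (bracket _ _)] at this
      rw [lieDeriv]
      linarith
    have hAA := h _ hA fun y _ => proj_mem _ _ _
    have hBB := h _ hB fun y _ => proj_mem _ _ _
    -- The bundle-like condition is quadratic in the horizontal field; its values at A, B and A + B
    -- polarise it.
    have hAB := h _ (hA.add hB) fun y _ =>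
      Submodule.add_mem _ (proj_mem (horizontal V) X y) (proj_mem (horizontal V) Y y)
    set A := proj (horizontal V) X
    set B := proj (horizontal V) Y
    set N := proj V Z
    have hm : metric (A + B) (A + B) = metric A A + metric A B + (metric A B + metric B B) := by
      funext y
      simp only [metric_apply, Pi.add_apply, inner_add_left, inner_add_right,
        real_inner_comm (A y) (B y)]
    have d {A B : VecField E M} (hA : SmoothOn A U) (hB : SmoothOn B U) :
        MDifferentiableAt 𝓘(ℝ, E) 𝓘(ℝ, ℝ) (metric A B) x :=
      mdifferentiableAt_of_contMDiffOn (contMDiffOn_metric hA hB) hU hx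
    rw [hm, lieDeriv_add ((d hA hA).add (d hA hB)) ((d hA hB).add (d hB hB)),
      lieDeriv_add (d hA hA) (d hA hB), lieDeriv_add (d hA hB) (d hB hB), hAA, hBB,
      metric_apply _ (A + B), bracket_add_right hU hx hA hB, Pi.add_apply, inner_add_left, inner_add_right,
      inner_add_right] at hAB
    simp only [metric_apply] at hAB ⊢
    linarith

/-- The vertical metric is invariant under the flows of horizontal vector fields. -/
theorem isInvariantSplitting_vertical : IsInvariantSplitting V (horizontal V) where
  eq_orthogonal_left _ := rfl
  eq_orthogonal_right := horizontal_orthogonal V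
  smoothOn_proj_left := SmoothOn.proj hV.smooth
  smoothOn_proj_right := hV.smoothOn_proj_horizontal
  invariant {U X Y Z} hU hX hY hZ x hx := by
    have hA : IsSection V (proj V X) U := ⟨SmoothOn.proj hV.smooth hX, fun y _ => proj_mem _ _ _⟩
    have hB : IsSection V (proj V Y) U := ⟨SmoothOn.proj hV.smooth hY, fun y _ => proj_mem _ _ _⟩
    have hN := hV.smoothOn_proj_horizontal hZ
    have hNx : proj (horizontal V) Z x ∈ (V x)ᗮ := proj_mem (horizontal V) Z x
    -- The Koszul formula for two vertical fields against a horizontal one: the left side vanishes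
    -- since the leaves are totally geodesic, the bracket term by involutivity, and two derivatives
    -- by orthogonality. What remains is the invariance.
    have h₁ := metric_leviCivita hU hx hA.1 hB.1 hN
    have h₃ : metric (leviCivita (proj V X) (proj V Y)) (proj (horizontal V) Z) x = 0 :=
      Submodule.inner_right_of_mem_orthogonal (hV.totallyGeodesic U hU _ _ hA hB x hx) hNx
    have h₄ : metric (bracket (proj V X) (proj V Y)) (proj (horizontal V) Z) x = 0 :=
      Submodule.inner_right_of_mem_orthogonal (hV.involutive U hU _ _ hA hB x hx) hNx
    rw [h₃, koszul_eq, h₄, metric_bracket_swap (proj V X), metric_bracket_swap (proj V Y)] at h₁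
    have h₂ (X : VecField E M) (W : VecField E M) :
        lieDeriv W (metric (proj V X) (proj (horizontal V) Z)) x = 0 := by
      rw [metric_proj_left, proj_proj_of_orthogonal (P := V) (Q := horizontal V) fun _ => rfl]
      have : metric X 0 = fun _ => 0 := funext fun _ => inner_zero_right _
      rw [this, lieDeriv_const]
    rw [h₂, h₂, Pi.neg_apply, Pi.neg_apply] at h₁
    linarith

/-- The horizontal part of the curvature of the Bott connection. -/
theorem isTransverseCurvature (x : M) :
    IsTransverseCurvature (V x) fun u v w =>
      partialCurvature (horizontal V) V (extendVec u) (extendVec v) (extendVec w) x := by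
  have h := hV.isInvariantSplitting_horizontal
  have hU := (trivializationAt E (TangentSpace 𝓘(ℝ, E) : M → Type _) x).open_baseSet
  have hx := FiberBundle.mem_baseSet_trivializationAt' (F := E)
    (E := (TangentSpace 𝓘(ℝ, E) : M → Type _)) x
  have e (v : TangentSpace 𝓘(ℝ, E) x) := extendVec_smoothOn v
  refine ⟨fun u v w => partialCurvature_mem (horizontal V) V _ _ _ x, fun u v w => ?_, fun u v w z => ?_,
    fun u v w => ?_⟩
  · exact h.partialCurvature_swap hV.involutive hU hx (e u) (e v) (e w)
  · have := h.metric_partialCurvature hU hx (e u) (e v) (e w) (e z)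
    rwa [metric_apply, metric_apply, extendVec_self, extendVec_self] at this
  · exact h.partialCurvature_bianchi hV.involutive hU hx (e u) (e v) (e w)

/-- The extension of w need not stay horizontal, so the vertical half must be removed. Its curvature
is skew, so pairing it with z moves w against a vertical vector, giving zero. -/
theorem bottCurvature_eq {x : M} (u v : TangentSpace 𝓘(ℝ, E) x) {w : TangentSpace 𝓘(ℝ, E) x}
    (hw : w ∈ (V x)ᗮ) : bottCurvature V x u v w =
      partialCurvature (horizontal V) V (extendVec u) (extendVec v) (extendVec w) x := by
  rw [bottCurvature_eq_add hV.isInvariantSplitting_horizontal, add_eq_left]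
  have h := hV.isInvariantSplitting_vertical
  have hU := (trivializationAt E (TangentSpace 𝓘(ℝ, E) : M → Type _) x).open_baseSet
  have hx := FiberBundle.mem_baseSet_trivializationAt' (F := E)
    (E := (TangentSpace 𝓘(ℝ, E) : M → Type _)) x
  refine ext_inner_right ℝ fun z => ?_
  have := h.metric_partialCurvature hU hx (extendVec_smoothOn u) (extendVec_smoothOn v)
    (extendVec_smoothOn w) (extendVec_smoothOn z)
  rw [metric_apply, metric_apply, extendVec_self, extendVec_self,
    hw _ (partialCurvature_mem _ _ _ _ _ _)] at this
  rw [this, neg_zero, inner_zero_left]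

end IsTotallyGeodesicRiemannianFoliation

end Foliation

/-! ### Dependence of the operators on the curvature -/

section Congr

variable {T : Type*} [NormedAddCommGroup T] [InnerProductSpace ℝ T] [FiniteDimensional ℝ T]
  {V : Submodule ℝ T} {R S : T → T → T → T}

/-- The third slot of the curvature is only ever filled with horizontal frame vectors. -/
theorem curvatureOperator_congr (h : ∀ u v, ∀ w ∈ Vᗮ, R u v w = S u v w) :
    curvatureOperator V R = curvatureOperator V S := by
  funext φ
  simp only [curvatureOperator, h _ _ _ (horizontalFrame_mem V _)]

theorem ricciOperator_congr (h : ∀ u v, ∀ w ∈ Vᗮ, R u v w = S u v w) :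
    ricciOperator V R = ricciOperator V S := by
  simp only [ricciOperator, ricciOne, ricciTwo, ricciOneVector, ricciTwoBivector,
    h _ _ _ (horizontalFrame_mem V _)]

end Congr

end BochnerFoliation

end

/-! ### The theorem on the manifold -/

open BochnerFoliation in
theorem mainTheorem6 {E : Type*} [NormedAddCommGroup E] [NormedSpace ℝ E] [FiniteDimensional ℝ E]
    {M : Type*} [TopologicalSpace M] [T2Space M] [ChartedSpace E M] [IsManifold 𝓘(ℝ, E) ∞ M]
    [RiemannianBundle (fun x : M => TangentSpace 𝓘(ℝ, E) x)]
    [IsContMDiffRiemannianBundle 𝓘(ℝ, E) ∞ E (fun x : M => TangentSpace 𝓘(ℝ, E) x)]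
    (n m : ℕ) (hdim : Module.finrank ℝ E = n + m)
    (V : ∀ x : M, Submodule ℝ (TangentSpace 𝓘(ℝ, E) x))
    (hV : IsTotallyGeodesicRiemannianFoliation V m)
    (c : ℝ) (hc : 0 < c)
    (hR : ∀ x : M, ∀ φ ∈ bidegree (V x) 2 0,
      c * formInner (V x) 1 φ φ ≤ formInner (V x) 1 (horizontalCurvatureOperator V x φ) φ) :
    ∃ c₁ : ℝ, 0 < c₁ ∧ ∀ i j : ℕ, i ≠ 0 → i ≠ n → ∀ x : M, ∀ α ∈ bidegree (V x) i j,
      ∀ ε : ℝ, 0 < ε →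
        c₁ * formInner (V x) ε α α ≤ formInner (V x) ε (horizontalRicciOperator V x α) α := by
  -- The curvature bound itself serves as constant, as i(n - i) ≥ 1 for integers 0 < i < n.
  refine ⟨c, hc, fun i j hi hin x α hα ε hε => ?_⟩
  have h (u v w : TangentSpace 𝓘(ℝ, E) x) (hw : w ∈ (V x)ᗮ) := hV.bottCurvature_eq u v hw
  have hRx := hR x
  simp only [horizontalCurvatureOperator, curvatureOperator_congr h] at hRx
  rw [horizontalRicciOperator, ricciOperator_congr h]
  refine le_formInner_ricciOperator (hV.isTransverseCurvature x) hc hRx hi ?_ hα hε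
  rwa [hV.smooth.finrank_orthogonal hdim]
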